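/- Let $(X,\mathcal B,\mu)$ be a standard Borel space with an atomless probability measure. Let $\mathrm{Aut}(\mu)$ be the set of automorphisms (invertible measure-preserving transformations, modulo null sets) of $(X,\mu)$, and equip $\mathrm{Aut}(\mu\otimes\mu)$ with the Halmos metric $$\rho(R,V)=\sum_i 2^{-i}\bigl((\mu\otimes\mu)(RA_i\,\Delta\,VA_i)+(\mu\otimes\mu)(R^{-1}A_i\,\Delta\,V^{-1}A_i)\bigr),$$ where $\{A_i\}$ is a fixed sequence of measurable sets dense in the measure algebra of $\mu\otimes\mu$. For $S\in\mathrm{Aut}(\mu)$ let $\mathrm{Ext}(S)\subset\mathrm{Aut}(\mu\otimes\mu)$ be the set of skew products $R(x,y)=(Sx,R_xy)$, where $\{R_x\}_{x\in X}$ is a measurable family of automorphisms of $(X,\mu)$. A subset of $\mathrm{Ext}(S)$ is called generic if it contains a dense $G_\delta$ subset of $\mathrm{Ext}(S)$. For a finite measurable partition $\xi=\{C_1,\dots,C_n\}$ of a probability space $(\bar X,\bar\mu)$ put $H(\xi)=-\sum_i\bar\mu(C_i)\ln\bar\mu(C_i)$. For a sequence $P=(P_j)$ of finite sets $P_j\subset\mathbb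 N$ and an automorphism $T$ of $(\bar X,\bar\mu)$ put $$h_P(T)=\sup_\xi\limsup_{j\to\infty}\frac1{|P_j|}H\Bigl(\bigvee_{p\in P_j}T^p\xi\Bigr),$$ where $\xi$ runs over the finite measurable partitions. Let $h(T)$ be the Kolmogorov–Sinai entropy. Below, $P$ is a sequence of progressions $P_j=\{j,2j,\dots,L(j)j\}$ with $L(j)\to\infty$. Then: 1. For every $S\in\mathrm{Aut}(\mu)$ with $h(S)=0$ there is such a sequence $P$ (that is, a choice of $L(j)\to\infty$) with $h_P(S)=0$. 2. For every such sequence $P$ and every $S\in\mathrm{Aut}(\mu)$, the set $\{R\in\mathrm{Ext}(S): h_P(R)=\infty\}$ is generic in $\mathrm{Ext}(S)$. 3. If $S\in\mathrm{Aut}(\mu)$ and $h(S)=0$, then the set of all $R\in\mathrm{Ext}(S)$ that are not isomorphic to $S$ is generic in $\mathrm{Ext}(S)$. 4. For every such sequence $P$, the family $F=\{S\in\mathrm{Aut}(\mu): h_P(S)<\infty\}$ is exquisite: for every $S\in F$, the set of all $R\in\mathrm{Ext}(S)$ that are not isomorphic to any $S'\in F$ is generic in $\mathrm{Ext}(S)$.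 -/

import Mathlib

open MeasureTheory Filter Set Topology
open scoped symmDiff

noncomputable section

namespace GenericExt

/-- An isomorphism modulo null sets of the measure spaces `(α, μ)` and `(β, ν)`: a pair of
measure-preserving maps that are inverse to each other almost everywhere. -/
structure AEIso {α β : Type*} [MeasurableSpace α] [MeasurableSpace β]
    (μ : Measure α) (ν : Measure β) where
  toFun : α → β
  invFun : β → α
  mp_toFun : MeasurePreserving toFun μ ν
  mp_invFun : MeasurePreserving invFun ν μ
  left_inv : ∀ᵐ x ∂μ, invFun (toFun x) = x
  right_inv : ∀ᵐ y ∂ν, toFun (invFun y) = y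

/-- Automorphisms of the measure space `(α, μ)` (invertible measure-preserving transformations,
modulo null sets). -/
abbrev MPAut {α : Type*} [MeasurableSpace α] (μ : Measure α) := AEIso μ μ

/-- Two automorphisms are isomorphic if they are conjugate by an isomorphism (modulo null sets) of
the underlying measure spaces. -/
def Isomorphic {α β : Type*} [MeasurableSpace α] [MeasurableSpace β]
    {μ : Measure α} {ν : Measure β} (R : MPAut μ) (S : MPAut ν) : Prop :=
  ∃ φ : AEIso μ ν, ∀ᵐ x ∂μ, φ.toFun (R.toFun x) = S.toFun (φ.toFun x)

/-! ### The Halmos metric -/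

/-- `{A i}` is a family of measurable sets that is dense in the measure algebra. -/
def IsDenseFamily {α : Type*} [MeasurableSpace α] (μ : Measure α) (A : ℕ → Set α) : Prop :=
  (∀ i, MeasurableSet (A i)) ∧
    ∀ B : Set α, MeasurableSet B → ∀ ε : ℝ, 0 < ε → ∃ i, μ.real (A i ∆ B) < ε

/-- The Halmos distance
`ρ(S, T) = ∑ i, 2⁻ⁱ (μ(S Aᵢ ∆ T Aᵢ) + μ(S⁻¹ Aᵢ ∆ T⁻¹ Aᵢ))`;
the image `S Aᵢ` is the preimage of `Aᵢ` under the inverse map. -/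
def halmosDist {α : Type*} [MeasurableSpace α] {μ : Measure α} (A : ℕ → Set α)
    (S T : MPAut μ) : ℝ :=
  ∑' i, (1 / 2 : ℝ) ^ i *
    (μ.real ((S.invFun ⁻¹' A i) ∆ (T.invFun ⁻¹' A i)) +
      μ.real ((S.toFun ⁻¹' A i) ∆ (T.toFun ⁻¹' A i)))

theorem halmosDist_summable {α : Type*} [MeasurableSpace α] {μ : Measure α}
    [IsProbabilityMeasure μ] (A : ℕ → Set α) (S T : MPAut μ) :
    Summable fun i => (1 / 2 : ℝ) ^ i *
      (μ.real ((S.invFun ⁻¹' A i) ∆ (T.invFun ⁻¹' A i)) +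
        μ.real ((S.toFun ⁻¹' A i) ∆ (T.toFun ⁻¹' A i))) := by
  refine Summable.of_nonneg_of_le (f := fun i => (1 / 2 : ℝ) ^ i * 2) (fun i => by positivity)
    (fun i => ?_) (summable_geometric_two.mul_right 2)
  have h1 := measureReal_le_one (μ := μ) (s := (S.invFun ⁻¹' A i) ∆ (T.invFun ⁻¹' A i))
  have h2 := measureReal_le_one (μ := μ) (s := (S.toFun ⁻¹' A i) ∆ (T.toFun ⁻¹' A i))
  exact mul_le_mul_of_nonneg_left (by linarith) (by positivity)

/-- The Halmos metric on the automorphisms of a probability space. Automorphisms that agree almost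
everywhere are at distance `0`, hence lie in the same open sets; identifying them is the same as
passing to the metric quotient, which changes neither density nor the `Gδ` property. -/
abbrev halmosMetric {α : Type*} [MeasurableSpace α] {μ : Measure α}
    [IsProbabilityMeasure μ] (A : ℕ → Set α) : PseudoMetricSpace (MPAut μ) where
  dist := halmosDist A
  dist_self S := by simp [halmosDist]
  dist_comm S T := by simp only [halmosDist, symmDiff_comm]
  dist_triangle S T U := by
    simp only [halmosDist]
    rw [← (halmosDist_summable A S T).tsum_add (halmosDist_summable A T U)]
    refine (halmosDist_summable A S U).tsum_le_tsum (fun i => ?_)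
      ((halmosDist_summable A S T).add (halmosDist_summable A T U))
    rw [← mul_add]
    have tri : ∀ s t u : Set α, μ.real (s ∆ u) ≤ μ.real (s ∆ t) + μ.real (t ∆ u) := fun s t u =>
      (measureReal_mono (symmDiff_triangle s t u)).trans (measureReal_union_le _ _)
    have h1 := tri (S.invFun ⁻¹' A i) (T.invFun ⁻¹' A i) (U.invFun ⁻¹' A i)
    have h2 := tri (S.toFun ⁻¹' A i) (T.toFun ⁻¹' A i) (U.toFun ⁻¹' A i)
    exact mul_le_mul_of_nonneg_left (by linarith) (by positivity)

/-- `W` is generic in the subspace `E` of the space of automorphisms with the Halmos metric: it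
contains a `Gδ` subset of `E` that is dense in `E`. -/
def IsGenericIn {α : Type*} [MeasurableSpace α] {μ : Measure α} [IsProbabilityMeasure μ]
    (A : ℕ → Set α) (E W : Set (MPAut μ)) : Prop :=
  letI := halmosMetric (μ := μ) A
  ∃ G : Set E, IsGδ G ∧ Dense G ∧ ∀ R ∈ G, (R : MPAut μ) ∈ W

/-! ### Extensions -/

/-- The extensions of `S` (skew products over `S`): automorphisms of the form
`R (x, y) = (S x, Rₓ y)`, where `{Rₓ}` is a measurable family of automorphisms. -/
def Ext {X : Type*} [MeasurableSpace X] {μ : Measure X} (S : MPAut μ) :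
    Set (MPAut (μ.prod μ)) :=
  {R | ∃ Q : X → MPAut μ, Measurable (fun z : X × X => (Q z.1).toFun z.2) ∧
    ∀ᵐ z ∂(μ.prod μ), R.toFun z = (S.toFun z.1, (Q z.1).toFun z.2)}

/-! ### Entropy -/

/-- The entropy `-∑ μ(Cᵢ) ln μ(Cᵢ)` of the finite partition into the sets `Cᵢ = {x | ξ x = i}`. -/
def partitionEntropy {α ι : Type*} [MeasurableSpace α] [Fintype ι] (μ : Measure α)
    (ξ : α → ι) : ℝ :=
  ∑ i, Real.negMulLog (μ.real (ξ ⁻¹' {i}))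

/-- The join of the partitions `T^p ξ`, `p ∈ P`: the point `x` lies in the `i`-th set of `T^p ξ` if
and only if `ξ (T^{-p} x) = i`. -/
def joinPartition {α ι : Type*} [MeasurableSpace α] {μ : Measure α} (T : MPAut μ)
    (P : Finset ℕ) (ξ : α → ι) : α → (P → ι) :=
  fun x p => ξ (T.invFun^[(p : ℕ)] x)

/-- The normalized entropy `|P|⁻¹ H(⋁_{p ∈ P} T^p ξ)`. -/
def meanEntropy {α ι : Type*} [MeasurableSpace α] [Fintype ι] {μ : Measure α} (T : MPAut μ)
    (P : Finset ℕ) (ξ : α → ι) : ℝ :=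
  partitionEntropy μ (joinPartition T P ξ) / P.card

/-- The `P`-entropy `h_P(T) = sup_ξ limsup_j |P_j|⁻¹ H(⋁_{p ∈ P_j} T^p ξ)`, where `ξ` runs over the
finite measurable partitions. -/
def seqEntropy {α : Type*} [MeasurableSpace α] {μ : Measure α} (P : ℕ → Finset ℕ)
    (T : MPAut μ) : EReal :=
  ⨆ (n : ℕ) (ξ : α → Fin n) (_ : Measurable ξ),
    limsup (fun j => ((meanEntropy T (P j) ξ : ℝ) : EReal)) atTop

/-- The Kolmogorov–Sinai entropy `h(T) = sup_ξ lim_n n⁻¹ H(ξ ∨ T ξ ∨ … ∨ T^{n-1} ξ)`. -/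
def ksEntropy {α : Type*} [MeasurableSpace α] {μ : Measure α} (T : MPAut μ) : EReal :=
  seqEntropy Finset.range T

/-- The arithmetic progressions `P_j = {j, 2j, …, L(j) j}`. -/
def progressions (L : ℕ → ℕ) (j : ℕ) : Finset ℕ :=
  (Finset.Icc 1 (L j)).image (fun n => n * j)

/-- A family `F` of automorphisms is exquisite if, for every `S ∈ F`, the generic extension of `S`
is not isomorphic to any member of `F`. -/
def IsExquisite {X : Type*} [MeasurableSpace X] {μ : Measure X} [IsProbabilityMeasure μ]
    (A : ℕ → Set (X × X)) (F : Set (MPAut μ)) : Prop :=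
  ∀ S ∈ F, IsGenericIn A (Ext S) {R | ¬ ∃ S' ∈ F, Isomorphic R S'}

end GenericExt

end

set_option linter.unusedSectionVars false

/-! Assertions 3 and 4 follow from 1 and 2, because `seqEntropy` is an isomorphism invariant. For 4,
a generic extension has infinite `P`-entropy and cannot be isomorphic to an automorphism whose
`P`-entropy is finite. For 3, the sequence `P` is the one that 1 provides for `S`.

Assertion 1 (`exists_seqEntropy_progressions_eq_zero`). The progression `{j, …, lj}` lies in an
interval of length `lj + 1`. If `h(S) = 0`, the join over that interval has entropy `o(lj)`, which
for fixed `j` is `o(l)`. So `L(j)` can be taken so large that the mean entropy of the `j`-th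
partition of a refining dense sequence is at most `1/(j+1)`.

Assertion 2 (`isGenericIn_seqEntropy_eq_top`). For a fixed finite partition and a fixed finite set
of times the mean entropy is continuous in the Halmos metric. Hence "the mean entropy over `P_j`
exceeds `k` for some `j ≥ N`" is an open condition, and intersecting over `k` and `N` gives a `Gδ`
set of extensions with infinite `P`-entropy. It remains to find a dense set of extensions that meet
all these conditions.

Density comes from adding noise (`exists_noisyMap_halmosDist_lt`). Any extension is close to one
whose fibre maps permute the cells of a fine uniform partition, by Birkhoff's theorem on doubly
stochastic matrices. Part of the fibre below the scale of the cells stores an independent past and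
future of noise. At each step one unit of noise is read, and with probability `δ` the visible point
is exchanged with a fresh random point. The exchange keeps the map invertible, and it alters the
action on cells only on a set of measure at most `δ`.

The noisy extension has large entropy along sparse times (`le_joinEntropy_noisySkewProduct`). Over
`j` steps a refresh occurs with probability `1 - (1-δ)^j`, so, given everything known `j` steps
earlier, the law of the visible point dominates that multiple of the uniform law. Each term of a
progression with step `j` thus contributes at least `(1 - (1-δ)^j) · n log 2` for the partition into
`n` bits, whatever `L(j) > 0` is. As `j → ∞` this tends to `n log 2`, and `n` is arbitrary. -/

noncomputable section

namespace GenericExt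

/-! ### Entropy of finite partitions. -/

section Entropy

variable {α ι κ : Type*} [MeasurableSpace α] {μ : Measure α} [IsProbabilityMeasure μ]
  [Fintype ι] [MeasurableSpace ι] [MeasurableSingletonClass ι]
  [Fintype κ] [MeasurableSpace κ] [MeasurableSingletonClass κ]

theorem partitionEntropy_nonneg (ξ : α → ι) : 0 ≤ partitionEntropy μ ξ :=
  Finset.sum_nonneg fun _ _ => Real.negMulLog_nonneg measureReal_nonneg measureReal_le_one

theorem measureReal_preimage_eq_sum {U : α → ι} (hU : Measurable U) {s : Set α}
    (hs : MeasurableSet s) : μ.real s = ∑ i, μ.real (s ∩ U ⁻¹' {i}) := by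
  classical
  rw [← measureReal_biUnion_finset]
  · congr 1; ext x; simp
  · intro i _ j _ hij
    refine Set.disjoint_left.2 fun x hx hx' => hij ?_
    have h1 : U x = i := hx.2
    have h2 : U x = j := hx'.2
    rw [← h1, h2]
  · exact fun i _ => hs.inter (hU (measurableSet_singleton i))

theorem measureReal_eq_sum_pair {U : α → ι} {V : α → κ} (hU : Measurable U) (hV : Measurable V)
    (u : ι) : μ.real (U ⁻¹' {u}) = ∑ v, μ.real ((fun x => (U x, V x)) ⁻¹' {(u, v)}) := by
  rw [measureReal_preimage_eq_sum hV (hU (measurableSet_singleton u))]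
  refine Finset.sum_congr rfl fun v _ => ?_
  congr 1; ext x; simp

theorem measureReal_eq_sum_pair' {U : α → ι} {V : α → κ} (hU : Measurable U) (hV : Measurable V)
    (v : κ) : μ.real (V ⁻¹' {v}) = ∑ u, μ.real ((fun x => (U x, V x)) ⁻¹' {(u, v)}) := by
  rw [measureReal_preimage_eq_sum hU (hV (measurableSet_singleton v))]
  refine Finset.sum_congr rfl fun u _ => ?_
  congr 1; ext x; simp [and_comm]

theorem sum_measureReal_preimage {U : α → ι} (hU : Measurable U) :
    ∑ i, μ.real (U ⁻¹' {i}) = 1 := by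
  have := measureReal_preimage_eq_sum (μ := μ) hU MeasurableSet.univ
  simpa using this.symm

theorem pair_le_fst (U : α → ι) (V : α → κ) (u : ι) (v : κ) :
    μ.real ((fun x => (U x, V x)) ⁻¹' {(u, v)}) ≤ μ.real (U ⁻¹' {u}) :=
  measureReal_mono (fun x hx => by simp at hx; exact hx.1)

/-- The chain rule for the entropy of a join. -/
theorem partitionEntropy_pair_eq {U : α → ι} {V : α → κ} (hU : Measurable U) (hV : Measurable V) :
    partitionEntropy μ (fun x => (U x, V x)) = partitionEntropy μ U +
      ∑ u, ∑ v, μ.real (U ⁻¹' {u}) * Real.negMulLog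
        (μ.real ((fun x => (U x, V x)) ⁻¹' {(u, v)}) / μ.real (U ⁻¹' {u})) := by
  unfold partitionEntropy
  rw [Fintype.sum_prod_type, ← Finset.sum_add_distrib]
  refine Finset.sum_congr rfl fun u _ => ?_
  set p := μ.real (U ⁻¹' {u})
  by_cases hp : p = 0
  · have h0 : ∀ v, μ.real ((fun x => (U x, V x)) ⁻¹' {(u, v)}) = 0 := fun v =>
      le_antisymm (hp ▸ pair_le_fst U V u v) measureReal_nonneg
    simp [hp, h0]
  · have hsum : ∑ v, μ.real ((fun x => (U x, V x)) ⁻¹' {(u, v)}) / p = 1 := by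
      rw [← Finset.sum_div, ← measureReal_eq_sum_pair hU hV, div_self hp]
    calc _ = ∑ v, (μ.real ((fun x => (U x, V x)) ⁻¹' {(u, v)}) / p * Real.negMulLog p +
          p * Real.negMulLog (μ.real ((fun x => (U x, V x)) ⁻¹' {(u, v)}) / p)) := by
          refine Finset.sum_congr rfl fun v _ => ?_
          rw [← Real.negMulLog_mul, mul_div_cancel₀ _ hp]
      _ = _ := by rw [Finset.sum_add_distrib, ← Finset.sum_mul, hsum, one_mul]

/-- By the chain rule the excess over the entropy of `U` is an average of `negMulLog` over the
conditional probabilities of each `v`; Jensen's inequality moves the average inside. -/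
theorem partitionEntropy_pair_le {U : α → ι} {V : α → κ} (hU : Measurable U) (hV : Measurable V) :
    partitionEntropy μ (fun x => (U x, V x)) ≤ partitionEntropy μ U + partitionEntropy μ V := by
  rw [partitionEntropy_pair_eq hU hV, Finset.sum_comm]
  refine add_le_add_right (Finset.sum_le_sum fun v _ => ?_) _
  have := Real.concaveOn_negMulLog.le_map_sum (t := Finset.univ)
    (w := fun u => μ.real (U ⁻¹' {u}))
    (p := fun u => μ.real ((fun x => (U x, V x)) ⁻¹' {(u, v)}) / μ.real (U ⁻¹' {u}))
    (fun _ _ => measureReal_nonneg) (sum_measureReal_preimage hU)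
    (fun _ _ => div_nonneg measureReal_nonneg measureReal_nonneg)
  simp only [smul_eq_mul] at this
  refine this.trans (le_of_eq ?_)
  congr 1
  rw [measureReal_eq_sum_pair' hU hV]
  refine Finset.sum_congr rfl fun u _ => ?_
  by_cases hp : μ.real (U ⁻¹' {u}) = 0
  · rw [hp, zero_mul]
    exact (le_antisymm (hp ▸ pair_le_fst U V u v) measureReal_nonneg).symm
  · rw [mul_div_cancel₀ _ hp]

theorem negMulLog_sum_le {β : Type*} (s : Finset β) (p : β → ℝ) (hp : ∀ i, 0 ≤ p i) :
    Real.negMulLog (∑ i ∈ s, p i) ≤ ∑ i ∈ s, Real.negMulLog (p i) := by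
  rw [Real.negMulLog, ← Finset.sum_neg_distrib, Finset.sum_mul]
  refine Finset.sum_le_sum fun i hi => ?_
  rw [Real.negMulLog]
  rcases (hp i).eq_or_lt with h | h
  · simp [← h]
  · have h2 : p i ≤ ∑ i ∈ s, p i := Finset.single_le_sum (fun j _ => hp j) hi
    have := Real.log_le_log h h2
    nlinarith

/-- Coarsening merges atoms, and `negMulLog` is subadditive on nonnegative reals. -/
theorem partitionEntropy_comp_le {U : α → ι} (hU : Measurable U) (f : ι → κ) :
    partitionEntropy μ (fun x => f (U x)) ≤ partitionEntropy μ U := by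
  classical
  unfold partitionEntropy
  have h1 : ∀ k, μ.real ((fun x => f (U x)) ⁻¹' {k}) =
      ∑ i with f i = k, μ.real (U ⁻¹' {i}) := by
    intro k
    rw [measureReal_preimage_eq_sum hU (s := (fun x => f (U x)) ⁻¹' {k})
      ((measurable_of_finite f).comp hU (measurableSet_singleton k)), Finset.sum_filter]
    refine Finset.sum_congr rfl fun i _ => ?_
    split_ifs with h
    · congr 1; ext x; simp only [mem_inter_iff, mem_preimage, mem_singleton_iff]
      exact ⟨fun h => h.2, fun hx => ⟨by rw [hx, h], hx⟩⟩
    · convert measureReal_empty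
      ext x; simp only [mem_inter_iff, mem_preimage, mem_singleton_iff, mem_empty_iff_false,
        iff_false, not_and]
      rintro h1 rfl
      exact h h1
  simp_rw [h1]
  refine (Finset.sum_le_sum fun k _ => negMulLog_sum_le _ _ fun i => measureReal_nonneg).trans ?_
  exact (Finset.sum_fiberwise Finset.univ f fun i => Real.negMulLog (μ.real (U ⁻¹' {i}))).le

/-- A Doeblin-type minorization of the conditional distributions bounds the conditional entropy
from below. -/
theorem partitionEntropy_pair_ge {U : α → ι} {V : α → κ} (hU : Measurable U) (hV : Measurable V)
    {c : ℝ} (hc0 : 0 ≤ c) (hc1 : c ≤ 1)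
    (h : ∀ u v, c / Fintype.card κ * μ.real (U ⁻¹' {u}) ≤
      μ.real ((fun x => (U x, V x)) ⁻¹' {(u, v)})) :
    partitionEntropy μ U + c * Real.log (Fintype.card κ) ≤
      partitionEntropy μ (fun x => (U x, V x)) := by
  rw [partitionEntropy_pair_eq hU hV]
  refine add_le_add_right ?_ _
  rw [← one_mul (c * _), ← sum_measureReal_preimage (μ := μ) hU, Finset.sum_mul]
  refine Finset.sum_le_sum fun u _ => ?_
  rw [← Finset.mul_sum]
  by_cases hp : μ.real (U ⁻¹' {u}) = 0
  · simp [hp]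
  refine mul_le_mul_of_nonneg_left ?_ measureReal_nonneg
  have hp' : 0 < μ.real (U ⁻¹' {u}) := lt_of_le_of_ne measureReal_nonneg (Ne.symm hp)
  set q : κ → ℝ := fun v => μ.real ((fun x => (U x, V x)) ⁻¹' {(u, v)}) / μ.real (U ⁻¹' {u})
  have hq : ∀ v, c / Fintype.card κ ≤ q v := fun v => by
    rw [le_div_iff₀ hp']; exact h u v
  have hsum : ∑ v, q v = 1 := by
    rw [← Finset.sum_div, ← measureReal_eq_sum_pair hU hV, div_self hp]
  have hne : Nonempty κ := by
    by_contra hκ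
    rw [not_nonempty_iff] at hκ
    simp at hsum
  have hN : (0 : ℝ) < Fintype.card κ := by exact_mod_cast Fintype.card_pos
  have hN1 : (1 : ℝ) ≤ Fintype.card κ := by exact_mod_cast Fintype.card_pos
  -- For `c = 1` the minorization forces the conditional law to be uniform; this case is separate
  -- because the other one divides by `1 - c`.
  rcases hc1.eq_or_lt with rfl | hc1
  · have hle : ∀ v, q v = 1 / Fintype.card κ := by
      have h2 : ∑ v : κ, (q v - 1 / Fintype.card κ) = 0 := by
        rw [Finset.sum_sub_distrib, hsum]; simp
      intro v
      have := (Finset.sum_eq_zero_iff_of_nonneg (fun v _ => sub_nonneg.2 (hq v))).1 h2 v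
        (Finset.mem_univ v)
      linarith
    have : ∑ v, Real.negMulLog (q v) = Real.log (Fintype.card κ) := by
      simp_rw [hle]
      rw [Finset.sum_const, Real.negMulLog]
      simp
    rw [one_mul, this]
  · have h1c : 0 < 1 - c := by linarith
    have key : ∀ v, c * Real.negMulLog (1 / Fintype.card κ) ≤ Real.negMulLog (q v) := by
      intro v
      -- The conditional law is the mixture `c · uniform + (1 - c) · r`. Concavity of `negMulLog`
      -- bounds its entropy below, and the nonnegative contribution of `r` is dropped.
      set r := (q v - c / Fintype.card κ) / (1 - c)
      have hr0 : 0 ≤ r := div_nonneg (by linarith [hq v]) h1c.le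
      have hr1 : r ≤ 1 := by
        rw [div_le_one h1c]
        have h3 : ∑ w : κ, (q w - c / Fintype.card κ) = 1 - c := by
          rw [Finset.sum_sub_distrib, hsum, Finset.sum_const, Finset.card_univ, nsmul_eq_mul,
            mul_div_cancel₀ _ hN.ne']
        rw [← h3]
        exact Finset.single_le_sum (f := fun w => q w - c / Fintype.card κ)
          (fun w _ => sub_nonneg.2 (hq w)) (Finset.mem_univ v)
      have := Real.concaveOn_negMulLog.2 (x := 1 / (Fintype.card κ : ℝ)) (y := r)
        (by rw [mem_Ici]; positivity) hr0 hc0 h1c.le (by ring)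
      simp only [smul_eq_mul] at this
      have e : c * (1 / (Fintype.card κ : ℝ)) + (1 - c) * r = q v := by
        simp only [r]; field_simp; ring
      rw [e] at this
      nlinarith [mul_nonneg h1c.le (Real.negMulLog_nonneg hr0 hr1)]
    calc c * Real.log (Fintype.card κ)
        = ∑ _v : κ, c * Real.negMulLog (1 / Fintype.card κ) := by
          rw [Finset.sum_const, Real.negMulLog]
          simp
          field_simp
      _ ≤ _ := Finset.sum_le_sum fun v _ => key v

theorem partitionEntropy_comp_measurePreserving {β : Type*} [MeasurableSpace β] {ν : Measure β}
    {f : β → α} (hf : MeasurePreserving f ν μ) {U : α → ι} (hU : Measurable U) :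
    partitionEntropy ν (fun x => U (f x)) = partitionEntropy μ U := by
  unfold partitionEntropy
  refine Finset.sum_congr rfl fun i _ => ?_
  congr 1
  exact hf.measureReal_preimage (hU (measurableSet_singleton i)).nullMeasurableSet

end Entropy

/-! ### Entropy of joins along a finite set of times. -/

section Join

variable {α ι κ : Type*} [MeasurableSpace α] {μ : Measure α} [IsProbabilityMeasure μ]
  [Fintype ι] [MeasurableSpace ι] [MeasurableSingletonClass ι]
  [Fintype κ] [MeasurableSpace κ] [MeasurableSingletonClass κ]

theorem measurable_joinPartition (T : MPAut μ) (P : Finset ℕ) {ξ : α → ι} (hξ : Measurable ξ) :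
    Measurable (joinPartition T P ξ) :=
  measurable_pi_lambda _ fun p => hξ.comp (T.mp_invFun.measurable.iterate p)

theorem joinEntropy_mono_subset (T : MPAut μ) {P Q : Finset ℕ} (h : P ⊆ Q) {ξ : α → ι}
    (hξ : Measurable ξ) :
    partitionEntropy μ (joinPartition T P ξ) ≤ partitionEntropy μ (joinPartition T Q ξ) :=
  partitionEntropy_comp_le (measurable_joinPartition T Q hξ)
    (fun (u : Q → ι) (p : P) => u ⟨p, h p.2⟩)

theorem joinEntropy_comp_le (T : MPAut μ) (P : Finset ℕ) {ξ : α → ι}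
    (hξ : Measurable ξ) (f : ι → κ) :
    partitionEntropy μ (joinPartition T P (fun x => f (ξ x))) ≤
      partitionEntropy μ (joinPartition T P ξ) :=
  partitionEntropy_comp_le (measurable_joinPartition T P hξ)
    (fun (u : P → ι) (p : P) => f (u p))

/-- With `le_joinEntropy_insert`, this passes between functions on `insert p P` and pairs: each of
the two partitions is a function of the other, even when `p ∈ P`. -/
theorem joinEntropy_insert_le (T : MPAut μ) (P : Finset ℕ) (p : ℕ) {ξ : α → ι}
    (hξ : Measurable ξ) :
    partitionEntropy μ (joinPartition T (insert p P) ξ) ≤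
      partitionEntropy μ (fun x => (joinPartition T P ξ x, ξ (T.invFun^[p] x))) := by
  classical
  refine le_of_eq_of_le ?_ (partitionEntropy_comp_le
    ((measurable_joinPartition T P hξ).prodMk (hξ.comp (T.mp_invFun.measurable.iterate p)))
    (fun (u : (P → ι) × ι) (q : (insert p P : Finset ℕ)) =>
      if h : (q : ℕ) ∈ P then u.1 ⟨q, h⟩ else u.2))
  congr 1
  funext x q
  by_cases h : (q : ℕ) ∈ P
  · simp [joinPartition, h]
  · have hq : (q : ℕ) = p := (Finset.mem_insert.1 q.2).resolve_right h
    have hp : p ∉ P := hq ▸ h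
    simp [joinPartition, hq, hp]

theorem le_joinEntropy_insert (T : MPAut μ) (P : Finset ℕ) (p : ℕ) {ξ : α → ι}
    (hξ : Measurable ξ) :
    partitionEntropy μ (fun x => (joinPartition T P ξ x, ξ (T.invFun^[p] x))) ≤
      partitionEntropy μ (joinPartition T (insert p P) ξ) :=
  partitionEntropy_comp_le (measurable_joinPartition T (insert p P) hξ)
    (fun (u : ((insert p P : Finset ℕ) : Type) → ι) =>
      ((fun q => u ⟨q.1, Finset.mem_insert_of_mem q.2⟩, u ⟨p, Finset.mem_insert_self p P⟩) :
        (P → ι) × ι))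

theorem joinEntropy_le_card_mul (T : MPAut μ) (P : Finset ℕ) {ξ : α → ι} (hξ : Measurable ξ) :
    partitionEntropy μ (joinPartition T P ξ) ≤ P.card * partitionEntropy μ ξ := by
  induction P using Finset.induction_on with
  | empty =>
    simp only [Finset.card_empty, Nat.cast_zero, zero_mul]
    unfold partitionEntropy
    refine Finset.sum_nonpos fun i _ => ?_
    have : joinPartition T ∅ ξ ⁻¹' {i} = univ := by
      ext x; simp [eq_iff_true_of_subsingleton]
    simp [this]
  | insert p P hp ih =>
    refine (joinEntropy_insert_le T P p hξ).trans ?_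
    have hm := hξ.comp (T.mp_invFun.measurable.iterate p)
    refine (partitionEntropy_pair_le (measurable_joinPartition T P hξ) hm).trans ?_
    have := partitionEntropy_comp_measurePreserving (T.mp_invFun.iterate p) hξ
    rw [Finset.card_insert_of_notMem hp]
    push_cast
    simp only [Function.comp_def]
    rw [this]
    linarith

/-- To be used with `η` an approximation to a partition and `ζ` a low-entropy correction from which,
together with `η`, the partition is recovered by `F`. -/
theorem joinEntropy_le_add (T : MPAut μ) (P : Finset ℕ) {τ : Type*} [Fintype τ]
    [MeasurableSpace τ] [MeasurableSingletonClass τ] {η : α → κ} {ζ : α → τ}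
    (hη : Measurable η) (hζ : Measurable ζ) (F : κ → τ → ι) :
    partitionEntropy μ (joinPartition T P (fun x => F (η x) (ζ x))) ≤
      partitionEntropy μ (joinPartition T P η) + P.card * partitionEntropy μ ζ := by
  have h1 := measurable_joinPartition T P hη
  have h2 := measurable_joinPartition T P hζ
  calc _ ≤ partitionEntropy μ (fun x => (joinPartition T P η x, joinPartition T P ζ x)) :=
        partitionEntropy_comp_le (h1.prodMk h2)
          (fun (u : (P → κ) × (P → τ)) (p : P) => F (u.1 p) (u.2 p))
    _ ≤ _ := (partitionEntropy_pair_le h1 h2).trans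
        (add_le_add_right (joinEntropy_le_card_mul T P hζ) _)

end Join

/-! ### Isomorphisms modulo null sets and invariance of sequence entropy. -/

section AEIso

variable {α β γ δ : Type*} [MeasurableSpace α] [MeasurableSpace β] [MeasurableSpace γ]
  [MeasurableSpace δ] {μ : Measure α} {ν : Measure β} {τ : Measure γ} {σ : Measure δ}

namespace AEIso

protected def refl (μ : Measure α) : AEIso μ μ :=
  ⟨id, id, MeasurePreserving.id μ, MeasurePreserving.id μ, by simp, by simp⟩

protected def symm (e : AEIso μ ν) : AEIso ν μ :=
  ⟨e.invFun, e.toFun, e.mp_invFun, e.mp_toFun, e.right_inv, e.left_inv⟩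

protected def trans (e : AEIso μ ν) (f : AEIso ν τ) : AEIso μ τ where
  toFun := f.toFun ∘ e.toFun
  invFun := e.invFun ∘ f.invFun
  mp_toFun := f.mp_toFun.comp e.mp_toFun
  mp_invFun := e.mp_invFun.comp f.mp_invFun
  left_inv := by
    filter_upwards [e.left_inv, e.mp_toFun.quasiMeasurePreserving.ae f.left_inv] with x h1 h2
    simp [h1, h2]
  right_inv := by
    filter_upwards [f.right_inv, f.mp_invFun.quasiMeasurePreserving.ae e.right_inv] with x h1 h2
    simp [h1, h2]

def ofMeasurableEquiv (e : α ≃ᵐ β) (h : MeasurePreserving e μ ν) : AEIso μ ν where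
  toFun := e
  invFun := e.symm
  mp_toFun := h
  mp_invFun := h.symm e
  left_inv := by simp
  right_inv := by simp

protected def prodMap [SFinite μ] [SFinite ν] [SFinite τ] [SFinite σ] (e : AEIso μ ν)
    (f : AEIso τ σ) : AEIso (μ.prod τ) (ν.prod σ) where
  toFun := Prod.map e.toFun f.toFun
  invFun := Prod.map e.invFun f.invFun
  mp_toFun := e.mp_toFun.prod f.mp_toFun
  mp_invFun := e.mp_invFun.prod f.mp_invFun
  left_inv := by
    filter_upwards [Measure.quasiMeasurePreserving_fst.ae e.left_inv,
      Measure.quasiMeasurePreserving_snd.ae f.left_inv] with x h1 h2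
    simp [Prod.map, h1, h2]
  right_inv := by
    filter_upwards [Measure.quasiMeasurePreserving_fst.ae e.right_inv,
      Measure.quasiMeasurePreserving_snd.ae f.right_inv] with x h1 h2
    simp [Prod.map, h1, h2]

def prodComm [SFinite μ] [SFinite ν] : AEIso (μ.prod ν) (ν.prod μ) :=
  ofMeasurableEquiv MeasurableEquiv.prodComm Measure.measurePreserving_swap

def prodAssoc [SFinite μ] [SFinite ν] [SFinite τ] :
    AEIso ((μ.prod ν).prod τ) (μ.prod (ν.prod τ)) :=
  ofMeasurableEquiv MeasurableEquiv.prodAssoc (measurePreserving_prodAssoc μ ν τ)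

/-- Iterates of an automorphism and of its inverse cancel almost everywhere. -/
theorem ae_iterate_toFun_invFun (T : MPAut μ) (n : ℕ) :
    ∀ᵐ x ∂μ, T.toFun^[n] (T.invFun^[n] x) = x := by
  induction n with
  | zero => simp
  | succ n ih =>
    filter_upwards [T.right_inv, T.mp_invFun.quasiMeasurePreserving.ae ih] with x h1 h2
    rw [Function.iterate_succ_apply' T.toFun, Function.iterate_succ_apply T.invFun, h2, h1]

end AEIso

/-- Joins are formed with iterates of `invFun`, so a conjugacy of the forward maps has to be
transferred to the inverses. -/
theorem AEIso.ae_semiconj_invFun {R : MPAut μ} {S : MPAut ν} {φ : AEIso μ ν}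
    (h : ∀ᵐ x ∂μ, φ.toFun (R.toFun x) = S.toFun (φ.toFun x)) (n : ℕ) :
    ∀ᵐ x ∂μ, φ.invFun (S.invFun^[n] (φ.toFun x)) = R.invFun^[n] x := by
  have h1 : ∀ᵐ x ∂μ, S.invFun (φ.toFun x) = φ.toFun (R.invFun x) := by
    filter_upwards [R.right_inv, R.mp_invFun.quasiMeasurePreserving.ae h,
      (φ.mp_toFun.comp R.mp_invFun).quasiMeasurePreserving.ae S.left_inv] with x h1 h2 h3
    rw [h1] at h2
    rw [h2]
    exact h3
  have h2 : ∀ᵐ x ∂μ, S.invFun^[n] (φ.toFun x) = φ.toFun (R.invFun^[n] x) := by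
    induction n with
    | zero => simp
    | succ n ih =>
      filter_upwards [h1, R.mp_invFun.quasiMeasurePreserving.ae ih] with x h2 h3
      rw [Function.iterate_succ_apply, Function.iterate_succ_apply, h2, h3]
  filter_upwards [h2, (R.mp_invFun.iterate n).quasiMeasurePreserving.ae φ.left_inv] with x h3 h4
  rw [h3, h4]

theorem meanEntropy_eq_of_semiconj {ι : Type*} [Fintype ι] [MeasurableSpace ι]
    [MeasurableSingletonClass ι] {R : MPAut μ} {S : MPAut ν} {φ : AEIso μ ν}
    (h : ∀ᵐ x ∂μ, φ.toFun (R.toFun x) = S.toFun (φ.toFun x)) (P : Finset ℕ) {ξ : α → ι}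
    (hξ : Measurable ξ) :
    meanEntropy S P (fun y => ξ (φ.invFun y)) = meanEntropy R P ξ := by
  unfold meanEntropy partitionEntropy
  congr 1
  refine Finset.sum_congr rfl fun u _ => ?_
  congr 1
  have hm : MeasurableSet (joinPartition S P (fun y => ξ (φ.invFun y)) ⁻¹' {u}) := by
    have : Measurable (joinPartition S P (fun y => ξ (φ.invFun y))) :=
      measurable_pi_lambda _ fun p => (hξ.comp φ.mp_invFun.measurable).comp
        (S.mp_invFun.measurable.iterate p)
    exact this (measurableSet_singleton u)
  rw [← φ.mp_toFun.measureReal_preimage hm.nullMeasurableSet]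
  refine measureReal_congr ?_
  have : ∀ᵐ x ∂μ, ∀ p : P, φ.invFun (S.invFun^[(p : ℕ)] (φ.toFun x)) = R.invFun^[(p : ℕ)] x :=
    ae_all_iff.2 fun p => AEIso.ae_semiconj_invFun h p
  filter_upwards [this] with x hx
  refine propext ?_
  change joinPartition S P (fun y => ξ (φ.invFun y)) (φ.toFun x) = u ↔ joinPartition R P ξ x = u
  have : joinPartition S P (fun y => ξ (φ.invFun y)) (φ.toFun x) = joinPartition R P ξ x := by
    funext p
    simp only [joinPartition, hx p]
  rw [this]

/-- Every partition of the first space is carried by `φ.invFun` to one with the same mean entropies.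
Only this inequality is needed later. -/
theorem seqEntropy_le_of_isomorphic {R : MPAut μ} {S : MPAut ν} (h : Isomorphic R S)
    (P : ℕ → Finset ℕ) : seqEntropy P R ≤ seqEntropy P S := by
  obtain ⟨φ, hφ⟩ := h
  refine iSup_le fun n => iSup_le fun ξ => iSup_le fun hξ => ?_
  refine le_iSup_of_le n (le_iSup_of_le (fun y => ξ (φ.invFun y))
    (le_iSup_of_le (hξ.comp φ.mp_invFun.measurable) ?_))
  simp_rw [meanEntropy_eq_of_semiconj hφ _ hξ]
  exact le_rfl

end AEIso

/-! ### All atomless standard probability spaces are isomorphic. -/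

section Classification

open ProbabilityTheory

/-- The quantile function of a probability measure on the line. -/
def quantile (ν : Measure ℝ) (u : ℝ) : ℝ :=
  if u ∈ Ioo (0 : ℝ) 1 then sInf {x | u ≤ cdf ν x} else 0

variable (ν : Measure ℝ)

theorem quantile_le_iff {u : ℝ} (hu : u ∈ Ioo (0 : ℝ) 1) (x : ℝ) :
    quantile ν u ≤ x ↔ u ≤ cdf ν x := by
  rw [quantile, if_pos hu]
  have hne : {x | u ≤ cdf ν x}.Nonempty :=
    (((tendsto_cdf_atTop ν).eventually (lt_mem_nhds hu.2)).exists).imp fun _ h => h.le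
  have hbdd : BddBelow {x | u ≤ cdf ν x} := by
    obtain ⟨b, hb⟩ := ((tendsto_cdf_atBot ν).eventually (gt_mem_nhds hu.1)).exists
    refine ⟨b, fun x hx => ?_⟩
    by_contra hlt
    exact absurd ((monotone_cdf ν (not_le.1 hlt).le).trans_lt hb) (not_lt.2 hx)
  constructor
  · intro h
    -- Right continuity of the distribution function shows that the infimum defining the quantile is
    -- attained.
    refine ge_of_tendsto (x := 𝓝[>] x) (f := cdf ν)
      (((cdf ν).right_continuous x).mono_left (nhdsWithin_mono _ Ioi_subset_Ici_self)) ?_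
    filter_upwards [self_mem_nhdsWithin] with y hy
    obtain ⟨z, hz, hzy⟩ := exists_lt_of_csInf_lt hne (lt_of_le_of_lt h hy)
    exact le_trans hz (monotone_cdf ν hzy.le)
  · exact fun h => csInf_le hbdd h

theorem measurable_quantile : Measurable (quantile ν) := by
  refine measurable_of_Iic fun x => ?_
  have : quantile ν ⁻¹' Iic x = (Ioo 0 1 ∩ Iic (cdf ν x)) ∪ ((Ioo 0 1)ᶜ ∩ {_u | (0 : ℝ) ≤ x}) := by
    ext u
    by_cases hu : u ∈ Ioo (0 : ℝ) 1
    · simp only [mem_preimage, mem_Iic, quantile_le_iff ν hu, mem_union, mem_inter_iff, hu,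
        true_and, mem_compl_iff, not_true, false_and, or_false]
    · simp only [mem_preimage, mem_Iic, quantile, mem_union, mem_inter_iff, hu,
        false_and, mem_compl_iff, not_false_iff, true_and, false_or, mem_ofPred_eq, if_false]
  rw [this]
  exact (measurableSet_Ioo.inter measurableSet_Iic).union
    (measurableSet_Ioo.compl.inter (MeasurableSet.const _))

variable [IsProbabilityMeasure ν]

theorem map_quantile : (volume.restrict (Ioo (0 : ℝ) 1)).map (quantile ν) = ν := by
  have : IsProbabilityMeasure (volume.restrict (Ioo (0 : ℝ) 1)) := ⟨by simp⟩
  have := Measure.isProbabilityMeasure_map (μ := volume.restrict (Ioo (0 : ℝ) 1))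
    (measurable_quantile ν).aemeasurable
  refine Measure.ext_of_Iic _ _ fun x => ?_
  rw [Measure.map_apply (measurable_quantile ν) measurableSet_Iic,
    Measure.restrict_apply (measurable_quantile ν measurableSet_Iic), ← ofReal_cdf ν x]
  have h1 : quantile ν ⁻¹' Iic x ∩ Ioo 0 1 = Ioo 0 1 ∩ Iic (cdf ν x) := by
    ext u
    constructor
    · exact fun h => ⟨h.2, (quantile_le_iff ν h.2 x).1 h.1⟩
    · exact fun h => ⟨(quantile_le_iff ν h.1 x).2 h.2, h.1⟩
  rw [h1]
  rcases (cdf_le_one ν x).eq_or_lt with h | h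
  · rw [h, inter_eq_left.2 (fun u hu => hu.2.le)]; simp
  · have : Ioo 0 1 ∩ Iic (cdf ν x) = Ioc 0 (cdf ν x) := by
      ext u
      exact ⟨fun hu => ⟨hu.1.1, hu.2⟩, fun hu => ⟨⟨hu.1, hu.2.trans_lt h⟩, hu.2⟩⟩
    rw [this]; simp

/-- Without atoms the distribution function has no jumps; an overshoot at the quantile would persist
slightly to its left, against minimality. -/
theorem cdf_quantile [NullSingletonClass ν] {u : ℝ} (hu : u ∈ Ioo (0 : ℝ) 1) :
    cdf ν (quantile ν u) = u := by
  refine le_antisymm ?_ ((quantile_le_iff ν hu _).1 le_rfl)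
  by_contra hlt
  rw [not_le] at hlt
  have h1 : ν {quantile ν u} = 0 := measure_singleton _
  nth_rw 1 [← measure_cdf ν] at h1
  rw [StieltjesFunction.measure_singleton, ENNReal.ofReal_eq_zero] at h1
  have h2 : u < Function.leftLim (cdf ν) (quantile ν u) := by linarith
  obtain ⟨y, hy1, hy2⟩ := (((monotone_cdf ν).tendsto_leftLim (quantile ν u)).eventually
    (lt_mem_nhds h2)).and self_mem_nhdsWithin |>.exists
  exact absurd ((quantile_le_iff ν hu y).2 hy1.le) (not_le.2 hy2)

/-- An atomless probability measure on the line is isomorphic to the Lebesgue measure on the unit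
interval. -/
def cdfIso [NullSingletonClass ν] : AEIso ν (volume.restrict (Ioo (0 : ℝ) 1)) :=
  have hF : Measurable (cdf ν) := (monotone_cdf ν).measurable
  have hr : ∀ᵐ u ∂(volume.restrict (Ioo (0 : ℝ) 1)), cdf ν (quantile ν u) = u :=
    (ae_restrict_mem measurableSet_Ioo).mono fun _ hu => cdf_quantile ν hu
  { toFun := cdf ν
    invFun := quantile ν
    mp_toFun := ⟨hF, by
      have h := congrArg (Measure.map (cdf ν)) (map_quantile ν)
      rw [← h, Measure.map_map hF (measurable_quantile ν)]
      exact (Measure.map_congr hr).trans Measure.map_id⟩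
    mp_invFun := ⟨measurable_quantile ν, map_quantile ν⟩
    left_inv := by
      -- Almost every point for `ν` is a quantile, since `ν` is the image of Lebesgue measure; at
      -- quantiles the identity follows from `hr`.
      have h : ∀ᵐ x ∂((volume.restrict (Ioo (0 : ℝ) 1)).map (quantile ν)),
          quantile ν (cdf ν x) = x := by
        refine (ae_map_iff (measurable_quantile ν).aemeasurable
          (measurableSet_eq_fun ((measurable_quantile ν).comp hF) measurable_id)).2 ?_
        exact hr.mono fun u hu => by simp [hu]
      rwa [map_quantile ν] at h
    right_inv := hr }

theorem nonempty_aeIso_unit {X : Type*} [MeasurableSpace X] [StandardBorelSpace X]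
    (μ : Measure X) [IsProbabilityMeasure μ] [NullSingletonClass μ] :
    Nonempty (AEIso μ (volume.restrict (Ioo (0 : ℝ) 1))) := by
  have hX : ¬ Countable X := by
    intro h
    have := (countable_univ (α := X)).measure_zero μ
    simp at this
  let e : X ≃ᵐ ℝ := PolishSpace.measurableEquivOfNotCountable hX (by simp [not_countable])
  have : IsProbabilityMeasure (μ.map e) :=
    Measure.isProbabilityMeasure_map e.measurable.aemeasurable
  have : NullSingletonClass (μ.map e) := ⟨fun x => by
    rw [e.map_apply]
    have : e ⁻¹' {x} = {e.symm x} := by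
      ext y; simp [← e.symm_apply_eq, eq_comm]
    rw [this, measure_singleton]⟩
  exact ⟨(AEIso.ofMeasurableEquiv e ⟨e.measurable, rfl⟩).trans (cdfIso _)⟩

/-- Any two atomless standard probability spaces are isomorphic. -/
theorem nonempty_aeIso {X Y : Type*} [MeasurableSpace X] [StandardBorelSpace X]
    [MeasurableSpace Y] [StandardBorelSpace Y]
    (μ : Measure X) [IsProbabilityMeasure μ] [NullSingletonClass μ]
    (ν : Measure Y) [IsProbabilityMeasure ν] [NullSingletonClass ν] : Nonempty (AEIso μ ν) :=
  let ⟨e⟩ := nonempty_aeIso_unit μ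
  let ⟨f⟩ := nonempty_aeIso_unit ν
  ⟨e.trans f.symm⟩

end Classification

/-! ### The model space of coin sequences. -/

section CoinSpace

/-- The fair coin. -/
def coin : Measure Bool := (2 : ENNReal)⁻¹ • (Measure.dirac true + Measure.dirac false)

theorem coin_singleton (b : Bool) : coin {b} = 2⁻¹ := by
  cases b <;> simp [coin]

instance : IsProbabilityMeasure coin := ⟨by
  simp only [coin, Measure.smul_apply, Measure.add_apply, measure_univ, smul_eq_mul]
  rw [one_add_one_eq_two, ENNReal.inv_mul_cancel (by simp) (by simp)]⟩

/-- The distribution of an infinite sequence of independent fair coins. -/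
def coinSeq : Measure (ℕ → Bool) := Measure.infinitePi fun _ => coin

instance : IsProbabilityMeasure coinSeq := by unfold coinSeq; infer_instance

/-- The distribution of `M` independent fair coins. -/
def coinPrefix (M : ℕ) : Measure (Fin M → Bool) := Measure.pi fun _ => coin

instance (M : ℕ) : IsProbabilityMeasure (coinPrefix M) := by unfold coinPrefix; infer_instance

theorem coinPrefix_singleton (M : ℕ) (a : Fin M → Bool) : coinPrefix M {a} = 2⁻¹ ^ M := by
  rw [coinPrefix, Measure.pi_singleton]
  simp [coin_singleton]

/-- Splitting off the first `M` bits of a sequence. -/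
def splitPrefix (M : ℕ) : (ℕ → Bool) ≃ᵐ (Fin M → Bool) × (ℕ → Bool) where
  toFun x := (fun i => x i, fun n => x (M + n))
  invFun p n := if h : n < M then p.1 ⟨n, h⟩ else p.2 (n - M)
  left_inv x := by
    funext n
    by_cases h : n < M
    · simp [h]
    · simp [h, Nat.add_sub_cancel' (not_lt.1 h)]
  right_inv p := by
    ext i <;> simp
  measurable_toFun := by
    simp only [Equiv.coe_fn_mk]
    fun_prop
  measurable_invFun := by
    refine measurable_pi_lambda _ fun n => ?_
    by_cases h : n < M
    · simp only [Equiv.coe_fn_symm_mk, h, dite_true]; fun_prop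
    · simp only [Equiv.coe_fn_symm_mk, h, dite_false]; fun_prop

theorem measurePreserving_splitPrefix (M : ℕ) :
    MeasurePreserving (splitPrefix M) coinSeq ((coinPrefix M).prod coinSeq) := by
  refine MeasurePreserving.symm (splitPrefix M).symm ⟨(splitPrefix M).symm.measurable, ?_⟩
  refine Measure.eq_infinitePi _ fun s t ht => ?_
  classical
  obtain ⟨N, hN⟩ : ∃ N, s ⊆ Finset.range (M + N) := by
    obtain ⟨N, hN⟩ := s.exists_nat_subset_range
    exact ⟨N, hN.trans (Finset.range_mono (Nat.le_add_left N M))⟩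
  -- Padding by `univ` makes the box a condition on all of the first `M + N` coordinates, which
  -- splits at `M`.
  set t' : ℕ → Set Bool := fun i => if i ∈ s then t i else univ
  have ht' : ∀ i, MeasurableSet (t' i) := fun i => .of_discrete
  have h1 : ∏ i ∈ s, coin (t i) = ∏ i ∈ Finset.range (M + N), coin (t' i) := by
    rw [← Finset.prod_subset hN]
    · exact Finset.prod_congr rfl fun i hi => by simp [t', hi]
    · intro i _ hi
      have : t' i = univ := if_neg hi
      rw [this, measure_univ]
  have h2 : (splitPrefix M).symm ⁻¹' (Set.pi s t) =
      (Set.pi univ fun i : Fin M => t' i) ×ˢ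
        (Set.pi (Finset.range N : Set ℕ) fun n => t' (M + n)) := by
    ext p
    simp only [mem_preimage, Set.mem_pi, mem_prod, mem_univ, forall_true_left, Finset.mem_coe,
      Finset.mem_range]
    have hp : ∀ n, (splitPrefix M).symm p n = if h : n < M then p.1 ⟨n, h⟩ else p.2 (n - M) :=
      fun n => rfl
    constructor
    · intro h
      refine ⟨fun i => ?_, fun n _ => ?_⟩
      · by_cases hi : (i : ℕ) ∈ s
        · simpa [t', hi, hp] using h i hi
        · simp [t', hi]
      · by_cases hi : M + n ∈ s
        · simpa [t', hi, hp] using h _ hi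
        · simp [t', hi]
    · rintro ⟨h3, h4⟩ i hi
      rw [hp]
      by_cases hM : i < M
      · simpa [t', hi, hM] using h3 ⟨i, hM⟩
      · have hiM : M + (i - M) = i := Nat.add_sub_cancel' (not_lt.1 hM)
        have := h4 (i - M) (by have := Finset.mem_range.1 (hN hi); omega)
        rw [hiM] at this
        simpa [t', hi, hM] using this
  rw [MeasurableEquiv.map_apply, h2, Measure.prod_prod, h1, Finset.prod_range_add, coinPrefix,
    Measure.pi_pi, coinSeq, Measure.infinitePi_pi _ (fun i _ => ht' _),
    Finset.prod_range (fun i => coin (t' i))]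

theorem coinSeq_prefix (M : ℕ) (a : Fin M → Bool) :
    coinSeq ((fun x (i : Fin M) => x i) ⁻¹' {a}) = 2⁻¹ ^ M := by
  have h := (measurePreserving_splitPrefix M).measure_preimage
    (s := {a} ×ˢ univ) (by measurability)
  rw [Measure.prod_prod, coinPrefix_singleton, measure_univ, mul_one] at h
  rw [← h]
  congr 1
  ext x
  simp [splitPrefix]

instance : NullSingletonClass coinSeq := ⟨fun x => by
  refine le_antisymm (ge_of_tendsto' (x := atTop) (f := fun M : ℕ => (2⁻¹ : ENNReal) ^ M)
    (ENNReal.tendsto_pow_atTop_nhds_zero_of_lt_one (by simp)) fun M => ?_) bot_le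
  rw [← coinSeq_prefix M (fun i => x i)]
  exact measure_mono (by simp)⟩

end CoinSpace

/-! ### Cells, and coordinates that separate visible bits from noise. -/

section Coordinates

/-- The `M`-th cell space: prefixes of length `M` of two sequences. -/
abbrev Cell (M : ℕ) := (Fin M → Bool) × (Fin M → Bool)

/-- The uniform distribution on cells. -/
abbrev cellMeasure (M : ℕ) : Measure (Cell M) := (coinPrefix M).prod (coinPrefix M)

theorem cellMeasure_singleton (M : ℕ) (k : Cell M) :
    cellMeasure M {k} = (Fintype.card (Cell M) : ENNReal)⁻¹ := by
  rw [← Prod.mk.eta (p := k), ← Set.singleton_prod_singleton, Measure.prod_prod,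
    coinPrefix_singleton, coinPrefix_singleton]
  simp only [Fintype.card_prod, Fintype.card_pi, Fintype.card_bool, Finset.prod_const,
    Finset.card_univ, Fintype.card_fin, Nat.cast_mul, Nat.cast_pow, Nat.cast_ofNat]
  rw [ENNReal.mul_inv (by simp) (by simp), ENNReal.inv_pow]

/-- The pair of prefixes of length `M`. -/
def toCell (M : ℕ) (y : (ℕ → Bool) × (ℕ → Bool)) : Cell M := (fun i => y.1 i, fun i => y.2 i)

theorem measurable_toCell (M : ℕ) : Measurable (toCell M) := by
  unfold toCell; fun_prop

/-- The restriction of prefixes. -/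
def cellRestrict {M N : ℕ} (h : M ≤ N) (k : Cell N) : Cell M :=
  (fun i => k.1 (Fin.castLE h i), fun i => k.2 (Fin.castLE h i))

variable {α β γ δ : Type*} [MeasurableSpace α] [MeasurableSpace β] [MeasurableSpace γ]
  [MeasurableSpace δ] {μ : Measure α} {ν : Measure β} {τ : Measure γ} {σ : Measure δ}

/-- `((a, b), (c, d)) ↦ ((a, c), b), d)`. -/
def AEIso.prodRearrange [SFinite μ] [SFinite ν] [SFinite τ] [SFinite σ] :
    AEIso ((μ.prod ν).prod (τ.prod σ)) (((μ.prod τ).prod ν).prod σ) :=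
  AEIso.prodAssoc.symm.trans
    ((AEIso.prodAssoc.trans (((AEIso.refl μ).prodMap AEIso.prodComm).trans
      AEIso.prodAssoc.symm)).prodMap (AEIso.refl σ))

variable (μ) in
/-- Coordinates in which the cell is the first coordinate. -/
def cellCoordinates (Θ : AEIso μ (coinSeq.prod coinSeq))
    (Ψ : AEIso coinSeq (coinSeq.prod coinSeq)) (M : ℕ) :
    AEIso μ (((cellMeasure M).prod coinSeq).prod (coinSeq.prod coinSeq)) :=
  -- The two prefixes form the cell. The tail of the first sequence stays beside it, so the
  -- component to be refreshed determines every bit of the first sequence, whatever `M` is. The tail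
  -- of the second sequence is split by `Ψ` into room for past and future noise.
  let sp := AEIso.ofMeasurableEquiv _ (measurePreserving_splitPrefix M)
  (Θ.trans (sp.prodMap sp)).trans (AEIso.prodRearrange.trans ((AEIso.refl _).prodMap Ψ))

/-- The first `c` bits of the first sequence, as a function of the cell and the rest of the first
sequence. -/
def headBits (M c : ℕ) (p : Cell M × (ℕ → Bool)) : Fin c → Bool :=
  fun i => (splitPrefix M).symm (p.1.1, p.2) i

theorem measurable_headBits (M c : ℕ) : Measurable (headBits M c) := by
  unfold headBits
  refine measurable_pi_lambda _ fun i => (measurable_pi_apply _).comp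
    ((splitPrefix M).symm.measurable.comp ?_)
  fun_prop

theorem headBits_cellCoordinates (Θ : AEIso μ (coinSeq.prod coinSeq))
    (Ψ : AEIso coinSeq (coinSeq.prod coinSeq)) (M c : ℕ) (x : α) :
    headBits M c ((cellCoordinates μ Θ Ψ M).toFun x).1 = fun i : Fin c => (Θ.toFun x).1 i := by
  funext i
  change (splitPrefix M).symm (splitPrefix M (Θ.toFun x).1) i = _
  rw [MeasurableEquiv.symm_apply_apply]

/-- Pulled back by the coordinates, the head bits are the first `c` coordinates of a coin sequence;
the choice of `Ψ` is immaterial. -/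
theorem measure_headBits (M c : ℕ) (g : Fin c → Bool) :
    ((cellMeasure M).prod coinSeq) (headBits M c ⁻¹' {g}) = 2⁻¹ ^ c := by
  obtain ⟨Ψ⟩ := nonempty_aeIso coinSeq (coinSeq.prod coinSeq)
  let Φ := cellCoordinates (coinSeq.prod coinSeq) (AEIso.refl _) Ψ M
  have h := (measurePreserving_fst.comp Φ.mp_toFun).measure_preimage
    (measurable_headBits M c (measurableSet_singleton g)).nullMeasurableSet
  rw [← h, ← preimage_comp]
  have h2 := measurePreserving_fst (μ := coinSeq) (ν := coinSeq) |>.measure_preimage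
    ((measurable_pi_lambda (fun (x : ℕ → Bool) (i : Fin c) => x i) fun i =>
      measurable_pi_apply _) (measurableSet_singleton g)).nullMeasurableSet
  rw [coinSeq_prefix, ← preimage_comp] at h2
  rw [← h2]
  congr 1
  ext x
  simp only [mem_preimage, Function.comp_apply, mem_singleton_iff]
  rw [headBits_cellCoordinates]
  rfl

end Coordinates

/-! ### Approximation by sets and functions that see the fibre only through cells. -/

section Approximation

theorem isSetAlgebra_cylinders (X : Type*) [MeasurableSpace X] :
    IsSetAlgebra {s : Set (X × ((ℕ → Bool) × (ℕ → Bool))) | ∃ (M : ℕ) (H : Set (X × Cell M)),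
      MeasurableSet H ∧ s = {z | (z.1, toCell M z.2) ∈ H}} where
  empty_mem := ⟨0, ∅, .empty, by simp⟩
  compl_mem := by
    rintro _ ⟨M, H, hH, rfl⟩
    exact ⟨M, Hᶜ, hH.compl, rfl⟩
  union_mem := by
    rintro _ _ ⟨M, H, hH, rfl⟩ ⟨M', H', hH', rfl⟩
    have hm : ∀ N (h : N ≤ max M M'), Measurable
        fun z : X × Cell (max M M') => (z.1, cellRestrict h z.2) := fun N h =>
      measurable_fst.prodMk ((measurable_of_finite (cellRestrict h)).comp measurable_snd)
    refine ⟨max M M', (fun z => (z.1, cellRestrict (le_max_left M M') z.2)) ⁻¹' H ∪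
      (fun z => (z.1, cellRestrict (le_max_right M M') z.2)) ⁻¹' H',
      (hm _ _ hH).union (hm _ _ hH'), ?_⟩
    ext z
    rfl

theorem generateFrom_cylinders (X : Type*) [MeasurableSpace X] :
    (inferInstance : MeasurableSpace (X × ((ℕ → Bool) × (ℕ → Bool)))) =
      MeasurableSpace.generateFrom {s | ∃ (M : ℕ) (H : Set (X × Cell M)),
        MeasurableSet H ∧ s = {z | (z.1, toCell M z.2) ∈ H}} := by
  set 𝒜 : Set (Set (X × ((ℕ → Bool) × (ℕ → Bool)))) := {s | ∃ (M : ℕ) (H : Set (X × Cell M)),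
        MeasurableSet H ∧ s = {z | (z.1, toCell M z.2) ∈ H}} with h𝒜
  refine le_antisymm ?_ (MeasurableSpace.generateFrom_le ?_)
  · have h1 : ∀ n, Measurable[MeasurableSpace.generateFrom 𝒜]
        (fun z : X × ((ℕ → Bool) × (ℕ → Bool)) => z.2.1 n) := fun n s _ =>
      MeasurableSpace.measurableSet_generateFrom ⟨n + 1, {p | p.2.1 (Fin.last n) ∈ s},
        (measurable_of_finite fun k : Cell (n + 1) => k.1 (Fin.last n)).comp measurable_snd
          (MeasurableSet.of_discrete (s := s)), rfl⟩
    have h2 : ∀ n, Measurable[MeasurableSpace.generateFrom 𝒜]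
        (fun z : X × ((ℕ → Bool) × (ℕ → Bool)) => z.2.2 n) := fun n s _ =>
      MeasurableSpace.measurableSet_generateFrom ⟨n + 1, {p | p.2.2 (Fin.last n) ∈ s},
        (measurable_of_finite fun k : Cell (n + 1) => k.2 (Fin.last n)).comp measurable_snd
          (MeasurableSet.of_discrete (s := s)), rfl⟩
    have h3 : Measurable[MeasurableSpace.generateFrom 𝒜]
        (fun z : X × ((ℕ → Bool) × (ℕ → Bool)) => z.2) :=
      have h1' : Measurable[MeasurableSpace.generateFrom 𝒜]
          (fun z : X × ((ℕ → Bool) × (ℕ → Bool)) => z.2.1) :=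
        @measurable_pi_lambda _ _ _ (MeasurableSpace.generateFrom 𝒜) _ _ h1
      have h2' : Measurable[MeasurableSpace.generateFrom 𝒜]
          (fun z : X × ((ℕ → Bool) × (ℕ → Bool)) => z.2.2) :=
        @measurable_pi_lambda _ _ _ (MeasurableSpace.generateFrom 𝒜) _ _ h2
      @Measurable.prodMk _ (MeasurableSpace.generateFrom 𝒜) _ _ _ _ _ _ h1' h2'
    refine sup_le ?_ (measurable_iff_comap_le.1 h3)
    rintro _ ⟨s, hs, rfl⟩
    exact MeasurableSpace.measurableSet_generateFrom ⟨0, Prod.fst ⁻¹' s, measurable_fst hs, rfl⟩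
  · rintro _ ⟨M, H, hH, rfl⟩
    exact (measurable_fst.prodMk ((measurable_toCell M).comp measurable_snd)) hH

variable {X Y : Type*} [MeasurableSpace X] [MeasurableSpace Y] {μ : Measure X} {ν : Measure Y}
  [IsProbabilityMeasure μ] [IsProbabilityMeasure ν]

theorem exists_cell_set_approx (Θ : AEIso ν (coinSeq.prod coinSeq)) {B : Set (X × Y)}
    (hB : MeasurableSet B) {ε : ℝ} (hε : 0 < ε) :
    ∃ M₀, ∀ M, M₀ ≤ M → ∃ H : Set (X × Cell M), MeasurableSet H ∧
      (μ.prod ν).real (B ∆ {z | (z.1, toCell M (Θ.toFun z.2)) ∈ H}) < ε := by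
  let e := (AEIso.refl μ).prodMap Θ
  obtain ⟨_, ⟨M₀, H₀, hH₀, rfl⟩, h⟩ :=
    (Measure.MeasureDense.of_generateFrom_isSetAlgebra_finite (μ.prod (coinSeq.prod coinSeq))
      (isSetAlgebra_cylinders X) (generateFrom_cylinders X)).approx (e.invFun ⁻¹' B)
      (e.mp_invFun.measurable hB) (measure_ne_top _ _) ε hε
  refine ⟨M₀, fun M hM => ⟨(fun z => (z.1, cellRestrict hM z.2)) ⁻¹' H₀,
    (measurable_fst.prodMk ((measurable_of_finite (cellRestrict hM)).comp measurable_snd)) hH₀, ?_⟩⟩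
  have hm : MeasurableSet {z : X × ((ℕ → Bool) × (ℕ → Bool)) | (z.1, toCell M₀ z.2) ∈ H₀} :=
    (measurable_fst.prodMk ((measurable_toCell M₀).comp measurable_snd)) hH₀
  rw [← e.mp_toFun.measure_preimage
    ((e.mp_invFun.measurable hB).symmDiff hm).nullMeasurableSet] at h
  refine (ENNReal.toReal_lt_of_lt_ofReal ?_ : _)
  refine lt_of_le_of_lt (measure_mono_ae ?_) h
  filter_upwards [e.left_inv] with z hz hzB
  change e.toFun z ∈ (e.invFun ⁻¹' B) ∆ _
  rw [Set.mem_symmDiff, mem_preimage, hz]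
  exact hzB

theorem exists_cell_fun_approx (Θ : AEIso ν (coinSeq.prod coinSeq)) {τ : Type*} [Fintype τ]
    [Nonempty τ] [MeasurableSpace τ] [MeasurableSingletonClass τ] {f : X × Y → τ}
    (hf : Measurable f) {ε : ℝ} (hε : 0 < ε) :
    ∃ M₀, ∀ M, M₀ ≤ M → ∃ H : X × Cell M → τ, Measurable H ∧
      (μ.prod ν).real {z | f z ≠ H (z.1, toCell M (Θ.toFun z.2))} < ε := by
  have hcard : (0 : ℝ) < Fintype.card τ := by exact_mod_cast Fintype.card_pos
  choose M₀ h using fun i : τ => exists_cell_set_approx (μ := μ) Θ (hf (measurableSet_singleton i))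
    (div_pos hε hcard)
  refine ⟨Finset.univ.sup M₀, fun M hM => ?_⟩
  choose H hH hlt using fun i => h i M ((Finset.le_sup (Finset.mem_univ i)).trans hM)
  classical
  -- Each level set of `f` is approximated separately, so the approximants may overlap or fail to
  -- cover. Off the union of the symmetric differences exactly one of them contains the point, and
  -- `G` recovers the value of `f`.
  let G : (τ → Bool) → τ := fun b => if h : ∃ i, b i = true then h.choose else Classical.arbitrary τ
  refine ⟨fun p => G fun i => decide (p ∈ H i), (measurable_of_finite G).comp
    (measurable_pi_lambda _ fun i => ?_), ?_⟩
  · refine measurable_to_bool ?_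
    convert hH i using 1
    ext p; simp
  · have hsub : {z : X × Y | f z ≠ G fun i => decide ((z.1, toCell M (Θ.toFun z.2)) ∈ H i)} ⊆
        ⋃ i ∈ (Finset.univ : Finset τ),
          (f ⁻¹' {i}) ∆ {z | (z.1, toCell M (Θ.toFun z.2)) ∈ H i} := by
      intro z hz
      by_contra hcon
      simp only [Finset.mem_univ, iUnion_true, mem_iUnion, not_exists, Set.mem_symmDiff,
        mem_preimage, mem_singleton_iff, mem_ofPred_eq] at hcon
      have hiff : ∀ i, f z = i ↔ (z.1, toCell M (Θ.toFun z.2)) ∈ H i := fun i => by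
        have := hcon i
        tauto
      have hex : ∃ i, decide ((z.1, toCell M (Θ.toFun z.2)) ∈ H i) = true :=
        ⟨f z, by simpa using (hiff _).1 rfl⟩
      refine hz ?_
      simp only [G, dif_pos hex]
      exact (hiff _).2 (by simpa using hex.choose_spec)
    calc _ ≤ _ := measureReal_mono hsub (measure_ne_top _ _)
      _ ≤ _ := measureReal_biUnion_finset_le _ _
      _ < ∑ _i : τ, ε / Fintype.card τ :=
        Finset.sum_lt_sum_of_nonempty Finset.univ_nonempty fun i _ => hlt i
      _ = ε := by simp; field_simp

end Approximation

/-! ### Skew products with countably many fibre maps. -/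

section SkewProduct

variable {X Y Γ : Type*} [MeasurableSpace X] [MeasurableSpace Y] [MeasurableSpace Γ] [Countable Γ]
  [MeasurableSingletonClass Γ] {μ : Measure X} {ν : Measure Y} [SFinite μ] [SFinite ν]

theorem measurable_countable_family {Z : Type*} [MeasurableSpace Z] {f : Γ → Y → Z}
    (hf : ∀ γ, Measurable (f γ)) {s : X → Γ} (hs : Measurable s) :
    Measurable fun z : X × Y => f (s z.1) z.2 :=
  (measurable_from_prod_countable_right (f := fun p : Γ × Y => f p.1 p.2) hf).comp
    ((hs.comp measurable_fst).prodMk measurable_snd)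

/-- The skew product over `S` whose fibre maps are chosen from a countable family. -/
def skewProduct (S : MPAut μ) {s : X → Γ} (hs : Measurable s) (Q : Γ → MPAut ν) :
    MPAut (μ.prod ν) where
  toFun z := (S.toFun z.1, (Q (s z.1)).toFun z.2)
  invFun z := (S.invFun z.1, (Q (s (S.invFun z.1))).invFun z.2)
  mp_toFun := S.mp_toFun.skew_product
    (measurable_countable_family (fun γ => (Q γ).mp_toFun.measurable) hs)
    (ae_of_all _ fun x => (Q (s x)).mp_toFun.map_eq)
  mp_invFun := S.mp_invFun.skew_product
    (measurable_countable_family (fun γ => (Q γ).mp_invFun.measurable)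
      (hs.comp S.mp_invFun.measurable))
    (ae_of_all _ fun x => (Q (s (S.invFun x))).mp_invFun.map_eq)
  left_inv := by
    filter_upwards [Measure.quasiMeasurePreserving_fst.ae S.left_inv,
      Measure.quasiMeasurePreserving_snd.ae (ae_all_iff.2 fun γ => (Q γ).left_inv)] with z h1 h2
    rw [h1, h2]
  right_inv := by
    filter_upwards [Measure.quasiMeasurePreserving_fst.ae S.right_inv,
      Measure.quasiMeasurePreserving_snd.ae (ae_all_iff.2 fun γ => (Q γ).right_inv)] with z h1 h2
    rw [h1, h2]

theorem skewProduct_mem_Ext {X : Type*} [MeasurableSpace X] {μ : Measure X} [SFinite μ]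
    (S : MPAut μ) {s : X → Γ} (hs : Measurable s) (Q : Γ → MPAut μ) :
    skewProduct S hs Q ∈ Ext S :=
  ⟨fun x => Q (s x), measurable_countable_family (fun γ => (Q γ).mp_toFun.measurable) hs,
    ae_of_all _ fun _ => rfl⟩

end SkewProduct

/-! ### The noisy skew product and its entropy along progressions. -/

section Refresh

variable {A Ω : Type*} [MeasurableSpace A] [MeasurableSpace Ω]

/-- A coin that shows `true` with probability `δ`. -/
def biasedCoin (δ : ℝ) : Measure Bool :=
  ENNReal.ofReal δ • Measure.dirac true + ENNReal.ofReal (1 - δ) • Measure.dirac false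

theorem isProbabilityMeasure_biasedCoin {δ : ℝ} (h0 : 0 ≤ δ) (h1 : δ ≤ 1) :
    IsProbabilityMeasure (biasedCoin δ) := ⟨by
  simp only [biasedCoin, Measure.add_apply, Measure.smul_apply, measure_univ, smul_eq_mul, mul_one]
  rw [← ENNReal.ofReal_add h0 (by linarith)]
  simp⟩

theorem lintegral_biasedCoin (δ : ℝ) (f : Bool → ENNReal) :
    ∫⁻ r, f r ∂(biasedCoin δ) = ENNReal.ofReal δ * f true + ENNReal.ofReal (1 - δ) * f false := by
  simp [biasedCoin, lintegral_add_measure, lintegral_smul_measure]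

variable (a : Measure A) [IsProbabilityMeasure a] (δ : ℝ)

/-- The distribution of one unit of noise: a biased coin and a point of `A`. -/
abbrev noise : Measure (Bool × A) := (biasedCoin δ).prod a

/-- If the coin shows `true`, swap the point with the point of the noise. -/
def refresh : MPAut (a.prod (noise a δ)) :=
  let e : AEIso (a.prod (noise a δ)) ((biasedCoin δ).prod (a.prod a)) :=
    AEIso.prodAssoc.symm.trans ((AEIso.prodComm.prodMap (AEIso.refl a)).trans AEIso.prodAssoc)
  e.trans ((skewProduct (AEIso.refl (biasedCoin δ)) measurable_id
    (fun r => bif r then AEIso.prodComm else AEIso.refl (a.prod a))).trans e.symm)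

theorem refresh_true (x y : A) : (refresh a δ).toFun (x, (true, y)) = (y, (true, x)) := rfl

theorem refresh_false (x y : A) : (refresh a δ).toFun (x, (false, y)) = (x, (false, y)) := rfl

variable {a δ} {ω : Measure Ω} [IsProbabilityMeasure ω]

/-- Read one unit of noise from the future, use it to refresh the point, and append the result to
the past. -/
def noisyShift (c : AEIso ((noise a δ).prod ω) ω) : MPAut (a.prod (ω.prod ω)) :=
  (((AEIso.refl a).prodMap (((AEIso.refl ω).prodMap c.symm).trans
    (AEIso.prodAssoc.symm.trans ((AEIso.prodComm.prodMap (AEIso.refl ω)).trans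
      AEIso.prodAssoc)))).trans AEIso.prodAssoc.symm).trans
  (((refresh a δ).prodMap (AEIso.refl (ω.prod ω))).trans
    (AEIso.prodAssoc.trans ((AEIso.refl a).prodMap
      (AEIso.prodAssoc.symm.trans (c.prodMap (AEIso.refl ω))))))

variable {X Γ : Type*} [MeasurableSpace X] [MeasurableSpace Γ] [Countable Γ]
  [MeasurableSingletonClass Γ] {μ : Measure X} [IsProbabilityMeasure μ]

/-- The fibre maps of the noisy skew product. -/
def noisyFibre (c : AEIso ((noise a δ).prod ω) ω) (g : Γ → MPAut a) (γ : Γ) :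
    MPAut (a.prod (ω.prod ω)) :=
  (noisyShift c).trans ((g γ).prodMap (AEIso.refl _))

variable (S : MPAut μ) {s : X → Γ} (hs : Measurable s) (g : Γ → MPAut a)
  (c : AEIso ((noise a δ).prod ω) ω)

/-- The skew product over `S` with noise. -/
def noisySkewProduct : MPAut (μ.prod (a.prod (ω.prod ω))) :=
  skewProduct S hs (noisyFibre c g)

/-- The past of a point of the noisy skew product: everything but the future noise. -/
def past (z : X × (A × (Ω × Ω))) : X × (A × Ω) := (z.1, (z.2.1, z.2.2.1))

theorem measurable_past : Measurable (past : X × (A × (Ω × Ω)) → _) := by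
  unfold past; fun_prop

/-- The action of the inverse of the noisy skew product on the past. -/
def pastInv (w : X × (A × Ω)) : X × (A × Ω) :=
  -- `p.1` is the unit of noise absorbed last. The inverse only hands it back to the future, so the
  -- past evolves backwards without consulting the future.
  let p := c.invFun w.2.2
  let x' := S.invFun w.1
  (x', (((refresh a δ).invFun ((g (s x')).invFun w.2.1, p.1)).1, p.2))

include hs in
theorem measurable_pastInv : Measurable (pastInv (s := s) S g c) := by
  have h1 : Measurable fun w : X × (A × Ω) => c.invFun w.2.2 :=
    c.mp_invFun.measurable.comp (measurable_snd.comp measurable_snd)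
  have h2 : Measurable fun w : X × (A × Ω) => S.invFun w.1 :=
    S.mp_invFun.measurable.comp measurable_fst
  have h3 : Measurable fun w : X × (A × Ω) => (g (s (S.invFun w.1))).invFun w.2.1 :=
    (measurable_countable_family (fun γ => (g γ).mp_invFun.measurable) hs).comp
      (h2.prodMk (measurable_fst.comp measurable_snd))
  exact h2.prodMk ((measurable_fst.comp ((refresh a δ).mp_invFun.measurable.comp
    (h3.prodMk (measurable_fst.comp h1)))).prodMk (measurable_snd.comp h1))

theorem past_invFun (z : X × (A × (Ω × Ω))) :
    past ((noisySkewProduct S hs g c).invFun z) = pastInv (s := s) S g c (past z) := rfl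

theorem past_invFun_iterate (n : ℕ) (z : X × (A × (Ω × Ω))) :
    past ((noisySkewProduct S hs g c).invFun^[n] z) = (pastInv (s := s) S g c)^[n] (past z) := by
  induction n generalizing z with
  | zero => rfl
  | succ n ih => rw [Function.iterate_succ_apply, ih, past_invFun, Function.iterate_succ_apply]

/-- The transition operator of the Markov chain formed by the base point and the point of `A`. -/
def transition (s : X → Γ) (f : X × A → ENNReal) (w : X × A) : ENNReal :=
  ∫⁻ e, f (S.toFun w.1, (g (s w.1)).toFun ((refresh a δ).toFun (w.2, e)).1) ∂(noise a δ)

include hs in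
theorem measurable_transition_integrand {f : X × A → ENNReal} (hf : Measurable f) :
    Measurable fun p : (X × A) × (Bool × A) =>
      f (S.toFun p.1.1, (g (s p.1.1)).toFun ((refresh a δ).toFun (p.1.2, p.2)).1) := by
  refine hf.comp ((S.mp_toFun.measurable.comp (measurable_fst.comp measurable_fst)).prodMk ?_)
  have h1 : Measurable fun p : (X × A) × (Bool × A) => ((refresh a δ).toFun (p.1.2, p.2)).1 :=
    measurable_fst.comp ((refresh a δ).mp_toFun.measurable.comp (by fun_prop))
  have h2 : Measurable fun p : (X × A) × (Bool × A) => p.1.1 := by fun_prop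
  exact (measurable_countable_family (fun γ => (g γ).mp_toFun.measurable) hs).comp (h2.prodMk h1)

include hs in
theorem measurable_transition {f : X × A → ENNReal} (hf : Measurable f) :
    Measurable (transition (δ := δ) S g s f) :=
  (measurable_transition_integrand (δ := δ) S hs g hf).lintegral_prod_right'

/-- With probability `δ` the point is resampled from `a`, a law that the fibre map preserves;
otherwise it just moves under the fibre map. -/
theorem transition_eq {f : X × A → ENNReal} (hf : Measurable f) (w : X × A) :
    transition (δ := δ) S g s f w =
      ENNReal.ofReal δ * ∫⁻ b, f (S.toFun w.1, b) ∂a +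
        ENNReal.ofReal (1 - δ) * f (S.toFun w.1, (g (s w.1)).toFun w.2) := by
  have hm : Measurable fun b => f (S.toFun w.1, b) := hf.comp (by fun_prop)
  unfold transition
  rw [lintegral_prod _ (Measurable.aemeasurable ?_), lintegral_biasedCoin]
  · simp only [refresh_true, refresh_false, lintegral_const, measure_univ, mul_one]
    rw [(g (s w.1)).mp_toFun.lintegral_comp hm]
  · exact hm.comp ((g _).mp_toFun.measurable.comp (measurable_fst.comp
      ((refresh a δ).mp_toFun.measurable.comp (by fun_prop))))

include hs in
-- The Markov property: the noise about to be read is independent of the past, so conditioning on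
-- the past averages `f` over one unit of noise.
theorem lintegral_past_step {φ : X × (A × Ω) → ENNReal} (hφ : Measurable φ)
    {f : X × A → ENNReal} (hf : Measurable f) :
    ∫⁻ z, φ (past z) * f (((noisySkewProduct S hs g c).toFun z).1,
        ((noisySkewProduct S hs g c).toFun z).2.1) ∂(μ.prod (a.prod (ω.prod ω))) =
      ∫⁻ z, φ (past z) * transition (δ := δ) S g s f (z.1, z.2.1)
        ∂(μ.prod (a.prod (ω.prod ω))) := by
  have hφp : Measurable fun z : X × (A × (Ω × Ω)) => φ (past z) := hφ.comp measurable_past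
  have hR := (noisySkewProduct S hs g c).mp_toFun.measurable
  have hG : Measurable fun z : X × (A × (Ω × Ω)) => φ (past z) *
      f (((noisySkewProduct S hs g c).toFun z).1, ((noisySkewProduct S hs g c).toFun z).2.1) :=
    hφp.mul (hf.comp ((measurable_fst.comp hR).prodMk (measurable_fst.comp (measurable_snd.comp hR))))
  have ht := measurable_transition (δ := δ) S hs g hf
  have hT : Measurable fun z : X × (A × (Ω × Ω)) => φ (past z) *
      transition (δ := δ) S g s f (z.1, z.2.1) := hφp.mul (ht.comp (by fun_prop))
  rw [lintegral_prod _ hG.aemeasurable, lintegral_prod _ hT.aemeasurable]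
  refine lintegral_congr fun x => ?_
  refine (lintegral_prod _ (hG.comp measurable_prodMk_left).aemeasurable).trans
    (Eq.trans ?_ (lintegral_prod _ (hT.comp measurable_prodMk_left).aemeasurable).symm)
  refine lintegral_congr fun b => ?_
  refine (lintegral_prod _
      ((hG.comp measurable_prodMk_left).comp measurable_prodMk_left).aemeasurable).trans
    (Eq.trans ?_ (lintegral_prod _
      ((hT.comp measurable_prodMk_left).comp measurable_prodMk_left).aemeasurable).symm)
  refine lintegral_congr fun p => ?_
  have hi : Measurable fun e : Bool × A =>
      f (S.toFun x, (g (s x)).toFun ((refresh a δ).toFun (b, e)).1) :=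
    (measurable_transition_integrand (δ := δ) S hs g hf).comp
      (measurable_prodMk_left (x := (x, b)))
  have h1 : ∀ t : Ω, f (((noisySkewProduct S hs g c).toFun (x, (b, (p, t)))).1,
      ((noisySkewProduct S hs g c).toFun (x, (b, (p, t)))).2.1) =
      f (S.toFun x, (g (s x)).toFun ((refresh a δ).toFun (b, (c.invFun t).1)).1) := fun t => rfl
  have h2 : ∀ t : Ω, past (x, (b, (p, t))) = (x, (b, p)) := fun t => rfl
  simp only [Function.comp_apply, h1, h2]
  rw [lintegral_const, measure_univ, mul_one, lintegral_const_mul]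
  · congr 1
    rw [c.mp_invFun.lintegral_comp
      (f := fun q : (Bool × A) × Ω =>
        f (S.toFun x, (g (s x)).toFun ((refresh a δ).toFun (b, q.1)).1)) (hi.comp measurable_fst)]
    refine ((measurePreserving_fst (μ := noise a δ) (ν := ω)).lintegral_comp hi)
  · exact hi.comp (measurable_fst.comp c.mp_invFun.measurable)

include hs in
-- Invariance of the measure trades `n` steps forward in `F` for `n` steps backward in the past.
theorem lintegral_past_iterate {φ : X × (A × Ω) → ENNReal} (hφ : Measurable φ)
    {F : X × (A × (Ω × Ω)) → ENNReal} (hF : Measurable F) (n : ℕ) :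
    ∫⁻ z, φ (past z) * F ((noisySkewProduct S hs g c).toFun^[n] z)
        ∂(μ.prod (a.prod (ω.prod ω))) =
      ∫⁻ z, φ ((pastInv (s := s) S g c)^[n] (past z)) * F z ∂(μ.prod (a.prod (ω.prod ω))) := by
  set R := noisySkewProduct S hs g c
  have hm : Measurable fun z => φ (past z) * F (R.toFun^[n] z) :=
    (hφ.comp measurable_past).mul (hF.comp (R.mp_toFun.measurable.iterate n))
  rw [← (R.mp_invFun.iterate n).lintegral_comp hm]
  refine lintegral_congr_ae ?_
  filter_upwards [AEIso.ae_iterate_toFun_invFun R n] with z hz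
  rw [hz, past_invFun_iterate]

theorem ofReal_refresh_succ (h0 : 0 ≤ δ) (h1 : δ ≤ 1) (k : ℕ) :
    ENNReal.ofReal (1 - (1 - δ) ^ (k + 1)) =
      ENNReal.ofReal δ + ENNReal.ofReal (1 - δ) * ENNReal.ofReal (1 - (1 - δ) ^ k) := by
  have h2 : (1 - δ) ^ k ≤ 1 := pow_le_one₀ (by linarith) (by linarith)
  rw [← ENNReal.ofReal_mul (by linarith), ← ENNReal.ofReal_add h0
    (mul_nonneg (by linarith) (by linarith))]
  congr 1
  ring

include hs in
/-- After `n` steps the distribution of the point of `A`, conditioned on the past, dominates the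
stationary distribution with the factor `1 - (1 - δ) ^ n`. -/
theorem le_lintegral_past_iterate (h0 : 0 ≤ δ) (h1 : δ ≤ 1) (q : ENNReal) (n : ℕ) :
    ∀ (k : ℕ) {f : X × A → ENNReal}, Measurable f → (∀ x, ∫⁻ b, f (x, b) ∂a = q) →
      (∀ w, ENNReal.ofReal (1 - (1 - δ) ^ k) * q ≤ f w) →
      ∀ {φ : X × (A × Ω) → ENNReal}, Measurable φ →
      ENNReal.ofReal (1 - (1 - δ) ^ (n + k)) * q * ∫⁻ z, φ (past z) ∂(μ.prod (a.prod (ω.prod ω))) ≤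
        ∫⁻ z, φ (past z) * f (((noisySkewProduct S hs g c).toFun^[n] z).1,
          ((noisySkewProduct S hs g c).toFun^[n] z).2.1) ∂(μ.prod (a.prod (ω.prod ω))) := by
  -- One application of `transition` keeps the fibre integrals equal to `q` and improves the
  -- pointwise lower bound from exponent `k` to `k + 1`; hence `f` and `k` vary in the induction.
  induction n with
  | zero =>
    intro k f hf hfq hfk φ hφ
    have hφp : Measurable fun z : X × (A × (Ω × Ω)) => φ (past z) := hφ.comp measurable_past
    rw [zero_add, ← lintegral_const_mul _ hφp]
    refine lintegral_mono fun z => ?_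
    rw [mul_comm]
    exact mul_le_mul_right (hfk _) _
  | succ n ih =>
    intro k f hf hfq hfk φ hφ
    set R := noisySkewProduct S hs g c with hR
    have hm := measurable_transition (δ := δ) S hs g hf
    have hF : Measurable fun z : X × (A × (Ω × Ω)) => f ((R.toFun z).1, (R.toFun z).2.1) := by
      have := R.mp_toFun.measurable
      exact hf.comp (by fun_prop)
    have hF' : Measurable fun z : X × (A × (Ω × Ω)) =>
      transition (δ := δ) S g s f (z.1, z.2.1) := hm.comp (by fun_prop)
    have key : ∫⁻ z, φ (past z) * f ((R.toFun^[n + 1] z).1, (R.toFun^[n + 1] z).2.1)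
          ∂(μ.prod (a.prod (ω.prod ω))) =
        ∫⁻ z, φ (past z) * transition (δ := δ) S g s f ((R.toFun^[n] z).1, (R.toFun^[n] z).2.1)
          ∂(μ.prod (a.prod (ω.prod ω))) := by
      simp only [Function.iterate_succ_apply']
      rw [lintegral_past_iterate S hs g c hφ hF n, lintegral_past_iterate S hs g c hφ hF' n]
      exact lintegral_past_step S hs g c
        (hφ.comp ((measurable_pastInv S hs g c).iterate n)) hf
    rw [key, show n + 1 + k = n + (k + 1) by omega]
    refine ih (k + 1) hm (fun x => ?_) (fun w => ?_) hφ
    · simp only [transition_eq S g hf, hfq]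
      have hx : Measurable fun b => f (S.toFun x, b) := hf.comp (by fun_prop)
      have hxg : Measurable fun b => f (S.toFun x, (g (s x)).toFun b) :=
        hx.comp (g (s x)).mp_toFun.measurable
      rw [lintegral_add_left measurable_const, lintegral_const, measure_univ, mul_one,
        lintegral_const_mul _ hxg,
        (g (s x)).mp_toFun.lintegral_comp hx, hfq, ← add_mul, ← ENNReal.ofReal_add h0 (by linarith)]
      simp
    · rw [transition_eq S g hf, hfq, ofReal_refresh_succ h0 h1, add_mul, mul_assoc]
      gcongr
      exact hfk _

section Entropy

variable {ι : Type*} [Fintype ι] [Nonempty ι] [MeasurableSpace ι] [MeasurableSingletonClass ι]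
  {ξ : A → ι}

/-- The partition of the noisy skew product induced by a partition of `A`. -/
abbrev liftPartition (ξ : A → ι) (z : X × (A × (Ω × Ω))) : ι := ξ z.2.1

include hs in
-- All times in `P` are at least `j`, so the join over `P` is a function of the past as it was `j`
-- steps ago; the present point has had `j` chances of being refreshed since then.
theorem pair_minorization (h0 : 0 ≤ δ) (h1 : δ ≤ 1) (hξ : Measurable ξ)
    (hu : ∀ i, a (ξ ⁻¹' {i}) = (Fintype.card ι : ENNReal)⁻¹) {P : Finset ℕ} {j : ℕ}
    (hP : ∀ p ∈ P, j ≤ p) (u : P → ι) (v : ι) :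
    (1 - (1 - δ) ^ j) / Fintype.card ι * (μ.prod (a.prod (ω.prod ω))).real
        (joinPartition (noisySkewProduct S hs g c) P (liftPartition ξ) ⁻¹' {u}) ≤
      (μ.prod (a.prod (ω.prod ω))).real ((fun z =>
        (joinPartition (noisySkewProduct S hs g c) P (liftPartition ξ) z, liftPartition ξ z)) ⁻¹'
          {(u, v)}) := by
  classical
  set m := μ.prod (a.prod (ω.prod ω))
  set R := noisySkewProduct S hs g c with hR
  set E : Set (X × (A × Ω)) :=
    {w | ∀ p : P, ξ ((pastInv (s := s) S g c)^[(p : ℕ) - j] w).2.1 = u p}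
  have hpi := measurable_pastInv S hs g c
  have hE : MeasurableSet E := by
    have : E = ⋂ p : P, (fun w => ξ ((pastInv (s := s) S g c)^[(p : ℕ) - j] w).2.1) ⁻¹' {u p} := by
      ext w; simp [E]
    rw [this]
    exact MeasurableSet.iInter fun p => (hξ.comp (measurable_fst.comp (measurable_snd.comp
      (hpi.iterate _)))) (measurableSet_singleton _)
  have hjoin : ∀ z, joinPartition R P (liftPartition ξ) z = u ↔
      (pastInv (s := s) S g c)^[j] (past z) ∈ E := by
    intro z
    simp only [E, mem_ofPred_eq, ← Function.iterate_add_apply, funext_iff, joinPartition]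
    refine forall_congr' fun p => ?_
    rw [Nat.sub_add_cancel (hP p p.2), ← past_invFun_iterate S hs g c]
    rfl
  set φ : X × (A × Ω) → ENNReal := E.indicator 1
  have hφ : Measurable φ := measurable_one.indicator hE
  set f : X × A → ENNReal := (Prod.snd ⁻¹' (ξ ⁻¹' {v})).indicator 1
  have hV : MeasurableSet (ξ ⁻¹' {v}) := hξ (measurableSet_singleton v)
  have hf : Measurable f := measurable_one.indicator (measurable_snd hV)
  have hfq : ∀ x, ∫⁻ b, f (x, b) ∂a = (Fintype.card ι : ENNReal)⁻¹ := fun x => by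
    rw [← hu v, ← lintegral_indicator_one hV]
    rfl
  have hF : Measurable fun z : X × (A × (Ω × Ω)) => f (z.1, z.2.1) := hf.comp (by fun_prop)
  -- With `k = 0` the pointwise hypothesis is void, since `1 - (1 - δ) ^ 0 = 0`.
  have main := le_lintegral_past_iterate S hs g c h0 h1 _ j 0 hf hfq (by simp) hφ
  rw [lintegral_past_iterate S hs g c hφ hF j, add_zero] at main
  have hone : ∫⁻ z, φ (past z) ∂m =
      ∫⁻ z, φ ((pastInv (s := s) S g c)^[j] (past z)) ∂m := by
    have := lintegral_past_iterate S hs g c (F := 1) hφ measurable_one j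
    simpa using this
  rw [hone] at main
  have hmU : MeasurableSet (joinPartition R P (liftPartition ξ) ⁻¹' {u}) :=
    measurable_joinPartition R P (hξ.comp (by fun_prop)) (measurableSet_singleton u)
  have hmV : MeasurableSet ((fun z => (joinPartition R P (liftPartition ξ) z,
      liftPartition ξ z)) ⁻¹' {(u, v)}) :=
    (measurable_joinPartition R P (hξ.comp (by fun_prop))).prodMk
      (hξ.comp (by fun_prop)) (measurableSet_singleton _)
  have e1 : ∫⁻ z, φ ((pastInv (s := s) S g c)^[j] (past z)) ∂m =
      m (joinPartition R P (liftPartition ξ) ⁻¹' {u}) := by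
    rw [← lintegral_indicator_one hmU]
    refine lintegral_congr fun z => ?_
    by_cases h : joinPartition R P (liftPartition ξ) z = u
    · simp [φ, (hjoin z).1 h, h]
    · simp [φ, h, mt (hjoin z).2 h]
  have e2 : ∫⁻ z, φ ((pastInv (s := s) S g c)^[j] (past z)) * f (z.1, z.2.1) ∂m =
      m ((fun z => (joinPartition R P (liftPartition ξ) z, liftPartition ξ z)) ⁻¹' {(u, v)}) := by
    rw [← lintegral_indicator_one hmV]
    refine lintegral_congr fun z => ?_
    by_cases h : joinPartition R P (liftPartition ξ) z = u
    · by_cases h' : ξ z.2.1 = v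
      · simp [φ, (hjoin z).1 h, h, f, h']
      · simp [φ, (hjoin z).1 h, h, f, h']
    · simp [φ, h, mt (hjoin z).2 h]
  rw [e1, e2] at main
  have := ENNReal.toReal_mono (measure_ne_top _ _) main
  have hpow : 0 ≤ 1 - (1 - δ) ^ j := sub_nonneg.2 (pow_le_one₀ (by linarith) (by linarith))
  rw [ENNReal.toReal_mul, ENNReal.toReal_mul, ENNReal.toReal_ofReal hpow, ENNReal.toReal_inv,
    ENNReal.toReal_natCast] at this
  exact this

theorem joinEntropy_shift_le {α : Type*} [MeasurableSpace α] {μ : Measure α}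
    [IsProbabilityMeasure μ] (T : MPAut μ) (P : Finset ℕ) (j : ℕ) {ξ : α → ι}
    (hξ : Measurable ξ) :
    partitionEntropy μ (joinPartition T P ξ) ≤
      partitionEntropy μ (joinPartition T (P.image (· + j)) ξ) := by
  rw [← partitionEntropy_comp_measurePreserving (T.mp_invFun.iterate j)
    (measurable_joinPartition T P hξ)]
  refine le_of_eq_of_le ?_ (partitionEntropy_comp_le
    (measurable_joinPartition T (P.image (· + j)) hξ)
    (fun (u : ((P.image (· + j) : Finset ℕ) : Type) → ι) =>
      (fun p => u ⟨p.1 + j, Finset.mem_image_of_mem (· + j) p.2⟩ : P → ι)))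
  congr 1
  funext x p
  simp only [joinPartition, Function.iterate_add_apply]

include hs in
theorem le_joinEntropy_noisySkewProduct (h0 : 0 ≤ δ) (h1 : δ ≤ 1) (hξ : Measurable ξ)
    (hu : ∀ i, a (ξ ⁻¹' {i}) = (Fintype.card ι : ENNReal)⁻¹) {j : ℕ} (l : ℕ) :
    l * ((1 - (1 - δ) ^ j) * Real.log (Fintype.card ι)) ≤
      partitionEntropy (μ.prod (a.prod (ω.prod ω))) (joinPartition (noisySkewProduct S hs g c)
        ((Finset.Icc 1 l).image (fun n => n * j)) (liftPartition ξ)) := by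
  induction l with
  | zero => simpa using partitionEntropy_nonneg _
  | succ l ih =>
    set P := (Finset.Icc 1 l).image (fun n => n * j)
    have hξ' : Measurable (liftPartition ξ : X × (A × (Ω × Ω)) → ι) := hξ.comp (by fun_prop)
    -- By stationarity the longer progression may be shifted back by `j`; it then consists of the
    -- shorter one and time `0`, which `pair_minorization` handles.
    have hP : (Finset.Icc 1 (l + 1)).image (fun n => n * j) = (insert 0 P).image (· + j) := by
      ext p
      simp only [P, Finset.mem_image, Finset.mem_Icc, Finset.mem_insert]
      constructor
      · rintro ⟨n, hn, rfl⟩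
        refine ⟨(n - 1) * j, ?_, by
          rw [← Nat.succ_mul]; congr 1; omega⟩
        rcases Nat.lt_or_ge 1 n with h | h
        · exact Or.inr ⟨n - 1, by omega, rfl⟩
        · left; simp [show n - 1 = 0 by omega]
      · rintro ⟨_, (rfl | ⟨n, hn, rfl⟩), rfl⟩
        · exact ⟨1, by omega, by ring⟩
        · exact ⟨n + 1, by omega, by ring⟩
    rw [hP]
    refine le_trans ?_ (joinEntropy_shift_le _ _ _ hξ')
    refine le_trans ?_ (le_joinEntropy_insert _ _ _ hξ')
    have hmin := pair_minorization S hs g c h0 h1 hξ hu (P := P) (j := j) (by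
      intro p hp
      obtain ⟨n, hn, rfl⟩ := Finset.mem_image.1 hp
      exact Nat.le_mul_of_pos_left j (Finset.mem_Icc.1 hn).1)
    have hpow0 : (0 : ℝ) ≤ (1 - δ) ^ j := pow_nonneg (by linarith) _
    have hpow : (1 - δ) ^ j ≤ 1 := pow_le_one₀ (by linarith) (by linarith)
    have := partitionEntropy_pair_ge (measurable_joinPartition (noisySkewProduct S hs g c) P hξ')
      hξ' (sub_nonneg.2 hpow) (by linarith) hmin
    simp only [Function.iterate_zero_apply]
    refine le_trans ?_ this
    push_cast
    linarith

theorem card_progressions (L : ℕ → ℕ) {j : ℕ} (hj : 0 < j) : (progressions L j).card = L j := by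
  rw [progressions, Finset.card_image_of_injective _ (mul_left_injective₀ hj.ne')]
  simp

include hs in
theorem le_meanEntropy_noisySkewProduct (h0 : 0 ≤ δ) (h1 : δ ≤ 1) (hξ : Measurable ξ)
    (hu : ∀ i, a (ξ ⁻¹' {i}) = (Fintype.card ι : ENNReal)⁻¹) (L : ℕ → ℕ) {j : ℕ} (hj : 0 < j)
    (hL : 0 < L j) :
    (1 - (1 - δ) ^ j) * Real.log (Fintype.card ι) ≤
      meanEntropy (noisySkewProduct S hs g c) (progressions L j) (liftPartition ξ) := by
  have hL' : (0 : ℝ) < L j := by exact_mod_cast hL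
  rw [meanEntropy, card_progressions L hj, le_div_iff₀ hL', mul_comm]
  exact le_joinEntropy_noisySkewProduct S hs g c h0 h1 hξ hu (L j)

end Entropy

end Refresh

/-! ### Approximating an automorphism by a permutation of cells. -/

section Permutations

/-- A linear functional on doubly stochastic matrices is bounded below by its value at some
permutation matrix. -/
theorem exists_perm_cost_le {K : Type*} [Fintype K] [DecidableEq K] {D : Matrix K K ℝ}
    (hD : D ∈ doublyStochastic ℝ K) (c : K → K → ℝ) :
    ∃ σ : Equiv.Perm K, ∑ a, c a (σ a) ≤ ∑ a, ∑ b, D a b * c a b := by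
  -- By Birkhoff's theorem the value at `D` is a weighted average of the values at permutations, and
  -- some permutation does no worse than the average.
  obtain ⟨w, hw0, hw1, hwD⟩ := exists_eq_sum_perm_of_mem_doublyStochastic hD
  have hval : ∑ a, ∑ b, D a b * c a b = ∑ σ, w σ * ∑ a, c a (σ a) := by
    have hDe : ∀ a b, D a b = ∑ σ : Equiv.Perm K, w σ * if σ a = b then 1 else 0 := by
      intro a b
      rw [← hwD, Matrix.sum_apply]
      refine Finset.sum_congr rfl fun σ _ => ?_
      rw [Matrix.smul_apply, smul_eq_mul, Equiv.Perm.permMatrix, PEquiv.toMatrix_apply]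
      congr 1
      by_cases h : σ a = b <;> simp [Equiv.toPEquiv_apply, h]
    calc ∑ a, ∑ b, D a b * c a b = ∑ a, ∑ σ : Equiv.Perm K, w σ * c a (σ a) := by
          refine Finset.sum_congr rfl fun a _ => ?_
          simp only [hDe, Finset.sum_mul]
          rw [Finset.sum_comm]
          exact Finset.sum_congr rfl fun σ _ => by simp
      _ = _ := by
          rw [Finset.sum_comm]
          simp only [Finset.mul_sum]
  by_contra! hlt
  have : ∑ σ, w σ * (∑ a, ∑ b, D a b * c a b) < ∑ σ, w σ * ∑ a, c a (σ a) := by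
    have hpos : ∃ σ, 0 < w σ := by
      by_contra! h
      have : ∑ σ, w σ ≤ 0 := Finset.sum_nonpos fun σ _ => h σ
      linarith
    obtain ⟨σ, hσ⟩ := hpos
    exact Finset.sum_lt_sum (fun σ _ => mul_le_mul_of_nonneg_left (hlt σ).le (hw0 σ))
      ⟨σ, Finset.mem_univ _, mul_lt_mul_of_pos_left (hlt σ) hσ⟩
  rw [← Finset.sum_mul, hw1, one_mul, ← hval] at this
  exact lt_irrefl _ this

theorem measureReal_pair_rel {Y K : Type*} [MeasurableSpace Y] {ν : Measure Y}
    [IsProbabilityMeasure ν] [Fintype K] [MeasurableSpace K] [MeasurableSingletonClass K]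
    {U V : Y → K} (hU : Measurable U) (hV : Measurable V) (r : K → K → Prop)
    [∀ a b, Decidable (r a b)] :
    ν.real {y | r (U y) (V y)} =
      ∑ a, ∑ b, ν.real ((fun y => (U y, V y)) ⁻¹' {(a, b)}) * if r a b then 1 else 0 := by
  classical
  rw [← Fintype.sum_prod_type' (f := fun a b =>
    ν.real ((fun y => (U y, V y)) ⁻¹' {(a, b)}) * if r a b then 1 else 0)]
  have hs : MeasurableSet {y | r (U y) (V y)} :=
    (hU.prodMk hV) (MeasurableSet.of_discrete (s := {p : K × K | r p.1 p.2}))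
  rw [measureReal_preimage_eq_sum (hU.prodMk hV) hs]
  refine Finset.sum_congr rfl fun p _ => ?_
  by_cases h : r p.1 p.2
  · rw [if_pos h, mul_one]
    congr 1
    ext y
    simp only [mem_inter_iff, mem_ofPred_eq, mem_preimage, mem_singleton_iff, Prod.ext_iff]
    constructor
    · exact fun h => h.2
    · rintro ⟨h1, h2⟩
      exact ⟨by rw [h1, h2]; exact h, h1, h2⟩
  · rw [if_neg h, mul_zero]
    convert measureReal_empty
    ext y
    simp only [mem_inter_iff, mem_ofPred_eq, mem_preimage, mem_singleton_iff, Prod.ext_iff,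
      mem_empty_iff_false, iff_false, not_and]
    intro h0 h1 h2
    rw [h1, h2] at h0
    exact h h0

/-- `q * n` is a probability vector. Two independent samples from it are compared through a common
reference, at distance `e` from each. -/
theorem sum_mul_sum_le {ι : Type*} [Fintype ι] {n e : ι → ℝ} {d : ι → ι → ℝ} {q : ℝ}
    (hq : 0 ≤ q) (hn : ∀ b, 0 ≤ n b) (h1 : q * ∑ b, n b = 1) (hd : ∀ b b', d b b' ≤ e b + e b') :
    ∑ b, q * n b * ∑ b', n b' * d b b' ≤ 2 * ∑ b, n b * e b := by
  calc ∑ b, q * n b * ∑ b', n b' * d b b'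
      ≤ ∑ b, q * n b * ∑ b', n b' * (e b + e b') :=
        Finset.sum_le_sum fun b _ => mul_le_mul_of_nonneg_left
          (Finset.sum_le_sum fun b' _ => mul_le_mul_of_nonneg_left (hd b b') (hn b'))
          (mul_nonneg hq (hn b))
    _ = ∑ b, (n b * e b + q * n b * ∑ b', n b' * e b') := by
        refine Finset.sum_congr rfl fun b _ => ?_
        simp only [mul_add, Finset.sum_add_distrib, ← Finset.sum_mul]
        linear_combination (n b * e b) * h1
    _ = _ := by
        rw [Finset.sum_add_distrib, ← Finset.sum_mul, ← Finset.mul_sum, h1]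
        ring

/-- An automorphism that moves the cells of a coarse partition approximately to unions of cells of
a fine uniform partition, and likewise for its inverse, acts on the coarse partition approximately
as a permutation of the fine cells. -/
theorem exists_perm_approx {Y K K₀ : Type*} [MeasurableSpace Y] {ν : Measure Y}
    [IsProbabilityMeasure ν] [Fintype K] [MeasurableSpace K] [MeasurableSingletonClass K]
    {cell : Y → K} (hcell : Measurable cell)
    (hunif : ∀ k, ν.real (cell ⁻¹' {k}) = (Fintype.card K : ℝ)⁻¹) {T : Y → Y}
    (hT : MeasurePreserving T ν ν) (pr H H' : K → K₀) :
    ∃ σ : Equiv.Perm K,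
      ν.real {y | pr (σ (cell y)) ≠ pr (cell (T y))} +
        ν.real {y | pr (σ.symm (cell (T y))) ≠ pr (cell y)} ≤
      2 * (ν.real {y | pr (cell (T y)) ≠ H (cell y)} +
        ν.real {y | pr (cell y) ≠ H' (cell (T y))}) := by
  classical
  have hcT : Measurable fun y => cell (T y) := hcell.comp hT.measurable
  set N : K → K → ℝ := fun a b => ν.real ((fun y => (cell y, cell (T y))) ⁻¹' {(a, b)}) with hN
  have hN0 : ∀ a b, 0 ≤ N a b := fun _ _ => measureReal_nonneg
  set q : ℝ := (Fintype.card K : ℝ)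
  have hq0 : 0 ≤ q := Nat.cast_nonneg _
  have hK : Nonempty K := by
    obtain ⟨y⟩ := nonempty_of_isProbabilityMeasure ν
    exact ⟨cell y⟩
  have hq : q ≠ 0 := by simp [q]
  have hrow : ∀ a, q * ∑ b, N a b = 1 := fun a => by
    rw [hN, ← measureReal_eq_sum_pair hcell hcT, hunif, mul_inv_cancel₀ hq]
  have hcol : ∀ b, q * ∑ a, N a b = 1 := fun b => by
    rw [hN, ← measureReal_eq_sum_pair' hcell hcT,
      show (fun y => cell (T y)) ⁻¹' {b} = T ⁻¹' (cell ⁻¹' {b}) from rfl,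
      hT.measureReal_preimage (hcell (measurableSet_singleton b)).nullMeasurableSet, hunif,
      mul_inv_cancel₀ hq]
  -- The transition matrix between cells is doubly stochastic because the cells have equal mass and
  -- `T` preserves it.
  have hD : (Matrix.of fun a b => q * N a b) ∈ doublyStochastic ℝ K := by
    rw [mem_doublyStochastic_iff_sum]
    refine ⟨fun a b => mul_nonneg hq0 (hN0 a b), fun a => ?_, fun b => ?_⟩
    · simpa [Finset.mul_sum] using hrow a
    · simpa [Finset.mul_sum] using hcol b
  let d : K₀ → K₀ → ℝ := fun u v => if u ≠ v then 1 else 0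
  have hd : ∀ u v w, d u v ≤ d u w + d v w := fun u v w => by
    simp only [d]
    split_ifs <;> first | (norm_num; done) | simp_all
  -- The cost of `(a, b)` is the error incurred by setting `σ a = b`: forward error in row `a` plus
  -- backward error in column `b`. Averaged over the matrix it compares two independent samples,
  -- with reference `H a` or `H' b`; this produces the factor 2.
  obtain ⟨σ, hσ⟩ := exists_perm_cost_le hD fun a b =>
    ∑ b', N a b' * d (pr b) (pr b') + ∑ a', N a' b * d (pr a) (pr a')
  refine ⟨σ, ?_⟩
  have e1 : ν.real {y | pr (σ (cell y)) ≠ pr (cell (T y))} =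
      ∑ a, ∑ b', N a b' * d (pr (σ a)) (pr b') :=
    measureReal_pair_rel hcell hcT (fun a b => pr (σ a) ≠ pr b)
  have e2 : ν.real {y | pr (σ.symm (cell (T y))) ≠ pr (cell y)} =
      ∑ a, ∑ a', N a' (σ a) * d (pr a) (pr a') := by
    rw [measureReal_pair_rel hcell hcT (fun a b => pr (σ.symm b) ≠ pr a), Finset.sum_comm,
      ← Equiv.sum_comp σ]
    simp [N, d]
  have e3 : ν.real {y | pr (cell (T y)) ≠ H (cell y)} = ∑ a, ∑ b, N a b * d (pr b) (H a) :=
    measureReal_pair_rel hcell hcT (fun a b => pr b ≠ H a)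
  have e4 : ν.real {y | pr (cell y) ≠ H' (cell (T y))} = ∑ a, ∑ b, N a b * d (pr a) (H' b) :=
    measureReal_pair_rel hcell hcT (fun a b => pr a ≠ H' b)
  have b1 : ∀ a, ∑ b, q * N a b * ∑ b', N a b' * d (pr b) (pr b') ≤
      2 * ∑ b, N a b * d (pr b) (H a) := fun a =>
    sum_mul_sum_le hq0 (hN0 a) (hrow a) fun b b' => hd _ _ _
  have b2 : ∀ b, ∑ a, q * N a b * ∑ a', N a' b * d (pr a) (pr a') ≤
      2 * ∑ a, N a b * d (pr a) (H' b) := fun b =>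
    sum_mul_sum_le (n := fun a => N a b) hq0 (fun a => hN0 a b) (hcol b) fun a a' => hd _ _ _
  rw [e1, e2, e3, e4, ← Finset.sum_add_distrib, mul_add, Finset.mul_sum]
  refine hσ.trans ?_
  simp only [Matrix.of_apply, mul_add, Finset.sum_add_distrib]
  refine add_le_add (Finset.sum_le_sum fun a _ => b1 a) ?_
  rw [Finset.sum_comm, Finset.sum_comm (f := fun a b => N a b * d (pr a) (H' b)), Finset.mul_sum]
  exact Finset.sum_le_sum fun b _ => b2 b

theorem exists_measurable_argmin {X Γ : Type*} [MeasurableSpace X] [Fintype Γ] [Nonempty Γ]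
    [MeasurableSpace Γ] [MeasurableSingletonClass Γ] {C : Γ → X → ENNReal}
    (hC : ∀ γ, Measurable (C γ)) : ∃ s : X → Γ, Measurable s ∧ ∀ x γ, C (s x) x ≤ C γ x := by
  classical
  -- The minimizer is read off from the finite table of comparisons, hence depends measurably on the
  -- point.
  let G : (Γ × Γ → Bool) → Γ := fun b =>
    if h : ∃ γ, ∀ γ', b (γ, γ') = true then h.choose else Classical.arbitrary Γ
  have hm : Measurable fun x (p : Γ × Γ) => decide (C p.1 x ≤ C p.2 x) := by
    refine measurable_pi_lambda _ fun p => measurable_to_bool ?_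
    convert measurableSet_le (hC p.1) (hC p.2) using 1
    ext x; simp
  refine ⟨fun x => G fun p => decide (C p.1 x ≤ C p.2 x), (measurable_of_finite G).comp hm,
    fun x γ => ?_⟩
  · have hex : ∃ γ, ∀ γ', decide (C γ x ≤ C γ' x) = true := by
      obtain ⟨γ, -, h⟩ := Finset.exists_min_image Finset.univ (fun γ => C γ x)
        Finset.univ_nonempty
      exact ⟨γ, fun γ' => by simpa using h γ' (Finset.mem_univ _)⟩
    simp only [G, dif_pos hex]
    simpa using hex.choose_spec γ

end Permutations

instance instMeasurableSpacePerm (K : Type*) : MeasurableSpace (Equiv.Perm K) := ⊤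

instance (K : Type*) : DiscreteMeasurableSpace (Equiv.Perm K) := ⟨fun _ => trivial⟩

/-! ### Measurable choice of the permutations. -/

section Selection

variable {X Y K K₀ : Type*} [MeasurableSpace X] [MeasurableSpace Y] {μ : Measure X} {ν : Measure Y}
  [IsProbabilityMeasure μ] [IsProbabilityMeasure ν] [Fintype K] [DecidableEq K]
  [MeasurableSpace K] [MeasurableSingletonClass K]

theorem measurableSet_finite_rel {Z W : Type*} [MeasurableSpace Z] [MeasurableSpace W]
    [DiscreteMeasurableSpace W] {u : Z → W} (hu : Measurable u) (r : W → Prop) :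
    MeasurableSet {z | r (u z)} :=
  hu (MeasurableSet.of_discrete (s := {w | r w}))

/-- The measurable version of `exists_perm_approx` for a family of automorphisms. -/
theorem exists_measurable_perm_approx [Fintype K₀] [MeasurableSpace K₀]
    [MeasurableSingletonClass K₀] {cell : Y → K} (hcell : Measurable cell)
    (hunif : ∀ k, ν.real (cell ⁻¹' {k}) = (Fintype.card K : ℝ)⁻¹) {Q : X → MPAut ν}
    (hQ : Measurable fun z : X × Y => (Q z.1).toFun z.2) (pr : K → K₀) {H H' : X × K → K₀}
    (hH : Measurable H) (hH' : Measurable H') :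
    ∃ s : X → Equiv.Perm K, Measurable s ∧
      (μ.prod ν).real {z | pr (s z.1 (cell z.2)) ≠ pr (cell ((Q z.1).toFun z.2))} +
        (μ.prod ν).real {z | pr ((s z.1).symm (cell ((Q z.1).toFun z.2))) ≠ pr (cell z.2)} ≤
      2 * ((μ.prod ν).real {z | pr (cell ((Q z.1).toFun z.2)) ≠ H (z.1, cell z.2)} +
        (μ.prod ν).real {z | pr (cell z.2) ≠ H' (z.1, cell ((Q z.1).toFun z.2))}) := by
  have hc : Measurable fun z : X × Y => cell z.2 := hcell.comp measurable_snd
  have hcQ : Measurable fun z : X × Y => cell ((Q z.1).toFun z.2) := hcell.comp hQ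
  have m3 : MeasurableSet {z : X × Y | pr (cell ((Q z.1).toFun z.2)) ≠ H (z.1, cell z.2)} :=
    measurableSet_finite_rel (hcQ.prodMk (hH.comp (measurable_fst.prodMk hc)))
      fun w => pr w.1 ≠ w.2
  have m4 : MeasurableSet {z : X × Y | pr (cell z.2) ≠ H' (z.1, cell ((Q z.1).toFun z.2))} :=
    measurableSet_finite_rel (hc.prodMk (hH'.comp (measurable_fst.prodMk hcQ)))
      fun w => pr w.1 ≠ w.2
  have m1 : ∀ {s : X → Equiv.Perm K}, Measurable s →
      MeasurableSet {z : X × Y | pr (s z.1 (cell z.2)) ≠ pr (cell ((Q z.1).toFun z.2))} :=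
    fun hs => measurableSet_finite_rel ((hs.comp measurable_fst).prodMk (hc.prodMk hcQ))
      fun w => pr (w.1 w.2.1) ≠ pr w.2.2
  have m2 : ∀ {s : X → Equiv.Perm K}, Measurable s →
      MeasurableSet {z : X × Y | pr ((s z.1).symm (cell ((Q z.1).toFun z.2))) ≠ pr (cell z.2)} :=
    fun hs => measurableSet_finite_rel ((hs.comp measurable_fst).prodMk (hc.prodMk hcQ))
      fun w => pr (w.1.symm w.2.2) ≠ pr w.2.1
  -- The best permutation in each fibre does at least as well as that of `exists_perm_approx`; the
  -- fibrewise bound is then integrated.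
  obtain ⟨s, hs, hmin⟩ := exists_measurable_argmin (X := X) (Γ := Equiv.Perm K)
    (C := fun σ x => ν {y | pr (σ (cell y)) ≠ pr (cell ((Q x).toFun y))} +
      ν {y | pr (σ.symm (cell ((Q x).toFun y))) ≠ pr (cell y)})
    (fun σ => (measurable_measure_prodMk_left (m1 (s := fun _ => σ) measurable_const)).add
      (measurable_measure_prodMk_left (m2 (s := fun _ => σ) measurable_const)))
  refine ⟨s, hs, ?_⟩
  have key : (μ.prod ν) {z | pr (s z.1 (cell z.2)) ≠ pr (cell ((Q z.1).toFun z.2))} +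
        (μ.prod ν) {z | pr ((s z.1).symm (cell ((Q z.1).toFun z.2))) ≠ pr (cell z.2)} ≤
      2 * ((μ.prod ν) {z | pr (cell ((Q z.1).toFun z.2)) ≠ H (z.1, cell z.2)} +
        (μ.prod ν) {z | pr (cell z.2) ≠ H' (z.1, cell ((Q z.1).toFun z.2))}) := by
    rw [Measure.prod_apply (m1 hs), Measure.prod_apply (m2 hs), Measure.prod_apply m3,
      Measure.prod_apply m4, ← lintegral_add_left (measurable_measure_prodMk_left (m1 hs)),
      ← lintegral_add_left (measurable_measure_prodMk_left m3),
      ← lintegral_const_mul' 2 _ (by simp)]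
    refine lintegral_mono fun x => ?_
    obtain ⟨σ, hσ⟩ := exists_perm_approx hcell hunif (Q x).mp_toFun pr (fun k => H (x, k))
      (fun k => H' (x, k))
    refine (hmin x σ).trans ?_
    have := ENNReal.ofReal_le_ofReal hσ
    rw [ENNReal.ofReal_add measureReal_nonneg measureReal_nonneg,
      ENNReal.ofReal_mul (by norm_num), ENNReal.ofReal_add measureReal_nonneg measureReal_nonneg,
      ofReal_measureReal, ofReal_measureReal, ofReal_measureReal, ofReal_measureReal] at this
    simpa using this
  have := ENNReal.toReal_mono (by finiteness) key
  rw [ENNReal.toReal_add (by finiteness) (by finiteness), ENNReal.toReal_mul,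
    ENNReal.toReal_add (by finiteness) (by finiteness), ENNReal.toReal_ofNat] at this
  exact this

end Selection

/-! ### Upper bounds for the Halmos distance. -/

section Halmos

variable {α : Type*} [MeasurableSpace α] {m : Measure α} [IsProbabilityMeasure m]

theorem halmosDist_le (A : ℕ → Set α) (R R₀ : MPAut m) {n : ℕ} {t : ℝ} (ht : 0 ≤ t)
    (h : ∀ i < n, m.real ((R.invFun ⁻¹' A i) ∆ (R₀.invFun ⁻¹' A i)) +
      m.real ((R.toFun ⁻¹' A i) ∆ (R₀.toFun ⁻¹' A i)) ≤ t) :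
    halmosDist A R R₀ ≤ 2 * t + 4 * (1 / 2) ^ n := by
  have hsum := halmosDist_summable A R R₀
  unfold halmosDist
  rw [← hsum.sum_add_tsum_nat_add n]
  refine add_le_add ?_ ?_
  · calc _ ≤ ∑ i ∈ Finset.range n, (1 / 2 : ℝ) ^ i * t :=
          Finset.sum_le_sum fun i hi => mul_le_mul_of_nonneg_left (h i (Finset.mem_range.1 hi))
            (by positivity)
      _ ≤ ∑' i, (1 / 2 : ℝ) ^ i * t :=
          (summable_geometric_two.mul_right t).sum_le_tsum _ fun i _ => by positivity
      _ = 2 * t := by rw [tsum_mul_right, tsum_geometric_two]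
  · calc _ ≤ ∑' i, (1 / 2 : ℝ) ^ i * (2 * (1 / 2) ^ n) := by
          refine ((summable_nat_add_iff n).2 hsum).tsum_le_tsum (fun i => ?_)
            (summable_geometric_two.mul_right _)
          have h1 := measureReal_le_one (μ := m)
            (s := (R.invFun ⁻¹' A (i + n)) ∆ (R₀.invFun ⁻¹' A (i + n)))
          have h2 := measureReal_le_one (μ := m)
            (s := (R.toFun ⁻¹' A (i + n)) ∆ (R₀.toFun ⁻¹' A (i + n)))
          rw [pow_add, mul_assoc, mul_comm (2 : ℝ)]
          exact mul_le_mul_of_nonneg_left (mul_le_mul_of_nonneg_left (by linarith) (by positivity))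
            (by positivity)
      _ = _ := by rw [tsum_mul_right, tsum_geometric_two]; ring

/-- If both images avoid the approximation error of `B` and have the same `κ`-value, they agree on
membership in `B`. Since `f` and `f'` preserve the measure, that error is counted twice. -/
theorem measureReal_symmDiff_preimage_le {X Y τ : Type*} [MeasurableSpace X] [MeasurableSpace Y]
    {μ : Measure X} {ν : Measure Y} [IsProbabilityMeasure μ] [IsProbabilityMeasure ν]
    {f f' : X × Y → X × Y} (hf : MeasurePreserving f (μ.prod ν) (μ.prod ν))
    (hf' : MeasurePreserving f' (μ.prod ν) (μ.prod ν))
    (hfst : ∀ᵐ z ∂(μ.prod ν), (f z).1 = (f' z).1) {B : Set (X × Y)} (hB : MeasurableSet B)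
    {κ : Y → τ} {H : Set (X × τ)} (hH : MeasurableSet {z : X × Y | (z.1, κ z.2) ∈ H}) :
    (μ.prod ν).real ((f ⁻¹' B) ∆ (f' ⁻¹' B)) ≤
      2 * (μ.prod ν).real (B ∆ {z | (z.1, κ z.2) ∈ H}) +
        (μ.prod ν).real {z | κ (f z).2 ≠ κ (f' z).2} := by
  set D := B ∆ {z : X × Y | (z.1, κ z.2) ∈ H} with hD
  have hDm : NullMeasurableSet D (μ.prod ν) := (hB.symmDiff hH).nullMeasurableSet
  have h1 := hf.measureReal_preimage hDm
  have h2 := hf'.measureReal_preimage hDm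
  calc (μ.prod ν).real ((f ⁻¹' B) ∆ (f' ⁻¹' B))
      ≤ (μ.prod ν).real ((f ⁻¹' D ∪ f' ⁻¹' D) ∪ {z | κ (f z).2 ≠ κ (f' z).2}) := by
        refine ENNReal.toReal_mono (measure_ne_top _ _) (measure_mono_ae ?_)
        filter_upwards [hfst] with z hz hzB
        by_contra hcon
        have hcon' : ¬ ((f z ∈ D ∨ f' z ∈ D) ∨ κ (f z).2 ≠ κ (f' z).2) := hcon
        simp only [not_or, not_not] at hcon'
        obtain ⟨⟨h3, h4⟩, h5⟩ := hcon'
        have hzB' : f z ∈ B ∧ f' z ∉ B ∨ f' z ∈ B ∧ f z ∉ B := hzB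
        have hiff : ((f z).1, κ (f z).2) ∈ H ↔ ((f' z).1, κ (f' z).2) ∈ H := by rw [hz, h5]
        simp only [hD, Set.mem_symmDiff, mem_ofPred_eq] at h3 h4
        tauto
    _ ≤ _ := by
        refine (measureReal_union_le _ _).trans (add_le_add_left ?_ _)
        refine (measureReal_union_le _ _).trans ?_
        rw [h1, h2]
        linarith

end Halmos

/-! ### Noisy extensions of `S`: entropy and density. -/

section NoisyExtension

variable {X : Type*} [MeasurableSpace X] {μ : Measure X} [IsProbabilityMeasure μ]

theorem measurePreserving_perm {K : Type*} [Fintype K] [MeasurableSpace K]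
    [MeasurableSingletonClass K] {κ : Measure K} {r : ENNReal} (h : ∀ k, κ {k} = r)
    (σ : Equiv.Perm K) : MeasurePreserving σ κ κ := by
  refine ⟨measurable_of_finite _, Measure.ext_of_singleton fun k => ?_⟩
  rw [Measure.map_apply (measurable_of_finite _) (measurableSet_singleton k), h]
  have : σ ⁻¹' {k} = {σ.symm k} := by
    ext x; simp [Equiv.eq_symm_apply]
  rw [this, h]

/-- The automorphism that permutes cells. -/
def cellPerm (M : ℕ) (σ : Equiv.Perm (Cell M)) : MPAut ((cellMeasure M).prod coinSeq) :=
  AEIso.prodMap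
    (μ := cellMeasure M) (ν := cellMeasure M)
    { toFun := σ
      invFun := σ.symm
      mp_toFun := measurePreserving_perm (cellMeasure_singleton M) σ
      mp_invFun := measurePreserving_perm (cellMeasure_singleton M) σ.symm
      left_inv := by simp
      right_inv := by simp }
    (AEIso.refl coinSeq)

variable (Θ : AEIso μ (coinSeq.prod coinSeq)) (Ψ : AEIso coinSeq (coinSeq.prod coinSeq)) {M : ℕ}
  {δ : ℝ} (c : AEIso ((noise ((cellMeasure M).prod coinSeq) δ).prod coinSeq) coinSeq)

/-- The noisy fibre maps, transported to the original fibre. -/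
def noisyMap (σ : Equiv.Perm (Cell M)) : MPAut μ :=
  (cellCoordinates μ Θ Ψ M).trans
    ((noisyFibre c (cellPerm M) σ).trans (cellCoordinates μ Θ Ψ M).symm)

variable (S : MPAut μ) {s : X → Equiv.Perm (Cell M)} (hs : Measurable s)

/-- The partition of `X × X` by the first `n` bits of the second coordinate. -/
def headPartition (n : ℕ) (z : X × X) : Fin n → Bool := fun i => (Θ.toFun z.2).1 i

theorem measurable_headPartition (n : ℕ) : Measurable (headPartition Θ n) :=
  measurable_pi_lambda _ fun _ => (measurable_pi_apply _).comp (measurable_fst.comp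
    (Θ.mp_toFun.measurable.comp measurable_snd))

theorem le_meanEntropy_noisyMap (h0 : 0 ≤ δ) (h1 : δ ≤ 1) (L : ℕ → ℕ) {j : ℕ} (hj : 0 < j)
    (hL : 0 < L j) (n : ℕ) :
    (1 - (1 - δ) ^ j) * (n * Real.log 2) ≤
      meanEntropy (skewProduct S hs (noisyMap Θ Ψ c)) (progressions L j) (headPartition Θ n) := by
  have hcard : Real.log (Fintype.card (Fin n → Bool)) = n * Real.log 2 := by simp
  have hu : ∀ g, ((cellMeasure M).prod coinSeq) (headBits M n ⁻¹' {g}) =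
      (Fintype.card (Fin n → Bool) : ENNReal)⁻¹ := fun g => by
    rw [measure_headBits]; simp [ENNReal.inv_pow]
  have hmain := le_meanEntropy_noisySkewProduct S hs (cellPerm M) c h0 h1
    (measurable_headBits M n) hu L hj hL
  rw [hcard] at hmain
  refine hmain.trans (le_of_eq ?_)
  let φ := ((AEIso.refl μ).prodMap (cellCoordinates μ Θ Ψ M)).symm
  have hsemi : ∀ᵐ w ∂(μ.prod (((cellMeasure M).prod coinSeq).prod (coinSeq.prod coinSeq))),
      φ.toFun ((noisySkewProduct S hs (cellPerm M) c).toFun w) =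
        (skewProduct S hs (noisyMap Θ Ψ c)).toFun (φ.toFun w) := by
    filter_upwards [Measure.quasiMeasurePreserving_snd.ae (cellCoordinates μ Θ Ψ M).right_inv]
      with w hw
    change (S.toFun w.1, (cellCoordinates μ Θ Ψ M).invFun
        ((noisyFibre c (cellPerm M) (s w.1)).toFun w.2)) =
      (S.toFun w.1, (cellCoordinates μ Θ Ψ M).invFun
        ((noisyFibre c (cellPerm M) (s w.1)).toFun
          ((cellCoordinates μ Θ Ψ M).toFun ((cellCoordinates μ Θ Ψ M).invFun w.2))))
    rw [hw]
  have hm : Measurable (liftPartition (headBits M n) :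
      X × ((Cell M × (ℕ → Bool)) × ((ℕ → Bool) × (ℕ → Bool))) → _) :=
    (measurable_headBits M n).comp (by fun_prop)
  rw [← meanEntropy_eq_of_semiconj hsemi (progressions L j) hm]
  congr 1
  funext z
  exact headBits_cellCoordinates Θ Ψ M n z.2

/-- The cell of a point of `X`. -/
def cellMap (M : ℕ) (x : X) : Cell M := toCell M (Θ.toFun x)

theorem measurable_cellMap (M : ℕ) : Measurable (cellMap Θ M) :=
  (measurable_toCell M).comp Θ.mp_toFun.measurable

theorem measureReal_cellMap (M : ℕ) (k : Cell M) :
    μ.real (cellMap Θ M ⁻¹' {k}) = (Fintype.card (Cell M) : ℝ)⁻¹ := by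
  obtain ⟨Ψ⟩ := nonempty_aeIso coinSeq (coinSeq.prod coinSeq)
  have h := ((measurePreserving_fst.comp measurePreserving_fst).comp
    (cellCoordinates μ Θ Ψ M).mp_toFun).measureReal_preimage
    (measurableSet_singleton k).nullMeasurableSet
  rw [measureReal_def (cellMeasure M), cellMeasure_singleton, ENNReal.toReal_inv,
    ENNReal.toReal_natCast] at h
  exact h

/-- The cell fails to move by the prescribed permutation only if the coin calls for a refresh. -/
theorem measureReal_cellMap_noisyMap_ne (h0 : 0 ≤ δ) (h1 : δ ≤ 1) :
    (μ.prod μ).real {z | cellMap Θ M ((noisyMap Θ Ψ c (s z.1)).toFun z.2) ≠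
      s z.1 (cellMap Θ M z.2)} ≤ δ := by
  have := isProbabilityMeasure_biasedCoin h0 h1
  set Φ := cellCoordinates μ Θ Ψ M with hΦ
  have hmp : MeasurePreserving
      (fun z : X × X => (c.invFun (Φ.toFun z.2).2.2).1.1) (μ.prod μ) (biasedCoin δ) :=
    measurePreserving_fst.comp (measurePreserving_fst.comp (c.mp_invFun.comp
      (measurePreserving_snd.comp (measurePreserving_snd.comp (Φ.mp_toFun.comp
        measurePreserving_snd)))))
  have hbad : (μ.prod μ).real ((fun z : X × X => (c.invFun (Φ.toFun z.2).2.2).1.1) ⁻¹' {true}) =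
      δ := by
    rw [hmp.measureReal_preimage (measurableSet_singleton true).nullMeasurableSet, measureReal_def]
    simp [biasedCoin, h0]
  refine le_trans ?_ hbad.le
  refine ENNReal.toReal_mono (measure_ne_top _ _) (measure_mono_ae ?_)
  have hr : ∀ᵐ y ∂μ, ∀ σ : Equiv.Perm (Cell M),
      Φ.toFun (Φ.invFun ((noisyFibre c (cellPerm M) σ).toFun (Φ.toFun y))) =
        (noisyFibre c (cellPerm M) σ).toFun (Φ.toFun y) :=
    ae_all_iff.2 fun σ => ((noisyFibre c (cellPerm M) σ).mp_toFun.comp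
      Φ.mp_toFun).quasiMeasurePreserving.ae Φ.right_inv
  filter_upwards [Measure.quasiMeasurePreserving_snd.ae hr] with z hz hzne
  by_contra hcon
  have hf : (c.invFun (Φ.toFun z.2).2.2).1.1 = false :=
    Bool.eq_false_of_not_eq_true hcon
  refine hzne ?_
  have h2 : cellMap Θ M ((noisyMap Θ Ψ c (s z.1)).toFun z.2) =
      ((noisyFibre c (cellPerm M) (s z.1)).toFun (Φ.toFun z.2)).1.1 := by
    rw [← hz]; rfl
  rw [h2]
  have h3 : ((noisyFibre c (cellPerm M) (s z.1)).toFun (Φ.toFun z.2)).1 =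
      (cellPerm M (s z.1)).toFun ((refresh ((cellMeasure M).prod coinSeq) δ).toFun
        ((Φ.toFun z.2).1, (c.invFun (Φ.toFun z.2).2.2).1)).1 := rfl
  have h4 : (c.invFun (Φ.toFun z.2).2.2).1 = (false, (c.invFun (Φ.toFun z.2).2.2).1.2) :=
    Prod.ext hf rfl
  rw [h3, h4, refresh_false]
  rfl

/-- The noisy extensions of `S` are dense among all extensions. -/
theorem exists_noisyMap_halmosDist_lt {A : ℕ → Set (X × X)} (hA : ∀ i, MeasurableSet (A i))
    {R₀ : MPAut (μ.prod μ)} (hR₀ : R₀ ∈ Ext S) {ε : ℝ} (hε : 0 < ε) :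
    ∃ (M : ℕ) (δ : ℝ) (_ : 0 < δ) (_ : δ ≤ 1)
      (c : AEIso ((noise ((cellMeasure M).prod coinSeq) δ).prod coinSeq) coinSeq)
      (s : X → Equiv.Perm (Cell M)) (hs : Measurable s),
      halmosDist A (skewProduct S hs (noisyMap Θ Ψ c)) R₀ < ε := by
  obtain ⟨Q, hQ, hRQ⟩ := hR₀
  obtain ⟨n, hn⟩ := exists_pow_lt_of_lt_one (show 0 < ε / 8 by positivity)
    (show (1 / 2 : ℝ) < 1 by norm_num)
  -- `t` bounds every approximation error and is also the coin's bias, whence `t ≤ 1`. The final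
  -- bound is `2 · 10t + 4 · 2⁻ⁿ ≤ ε/4 + ε/2`.
  set t : ℝ := min 1 (ε / 80)
  have ht0 : 0 < t := lt_min one_pos (by positivity)
  have ht1 : t ≤ 1 := min_le_left _ _
  have htε : t ≤ ε / 80 := min_le_right _ _
  -- coarse cells
  choose M₀ hM₀ using fun i => exists_cell_set_approx (μ := μ) Θ (hA i) ht0
  set N := (Finset.range n).sup M₀
  have hN : ∀ i < n, ∃ H : Set (X × Cell N), MeasurableSet H ∧
      (μ.prod μ).real (A i ∆ {z | (z.1, cellMap Θ N z.2) ∈ H}) < t := fun i hi =>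
    hM₀ i N (Finset.le_sup (f := M₀) (Finset.mem_range.2 hi))
  -- fine cells
  have hcN : Measurable fun z : X × X => cellMap Θ N z.2 :=
    (measurable_cellMap Θ N).comp measurable_snd
  obtain ⟨M₁, hM₁⟩ := exists_cell_fun_approx (μ := μ) Θ
    (hcN.comp R₀.mp_toFun.measurable) ht0
  obtain ⟨M₂, hM₂⟩ := exists_cell_fun_approx (μ := μ) Θ
    (hcN.comp R₀.mp_invFun.measurable) ht0
  set M := max N (max M₁ M₂)
  have hNM : N ≤ M := le_max_left _ _
  obtain ⟨H, hH, e3⟩ := hM₁ M ((le_max_left _ _).trans (le_max_right _ _))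
  obtain ⟨H', hH', e4⟩ := hM₂ M ((le_max_right _ _).trans (le_max_right _ _))
  set pr : Cell M → Cell N := cellRestrict hNM
  have hpr : ∀ x, pr (cellMap Θ M x) = cellMap Θ N x := fun x => rfl
  -- `H'` predicts the coarse cell of the preimage from the base point of the image, which is `S x`
  -- when expressed at the source.
  obtain ⟨s, hs, hB⟩ := exists_measurable_perm_approx (μ := μ) (measurable_cellMap Θ M)
    (measureReal_cellMap Θ M) hQ pr hH (H' := fun p => H' (S.toFun p.1, p.2))
    (hH'.comp ((S.mp_toFun.measurable.comp measurable_fst).prodMk measurable_snd))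
  have hprob := isProbabilityMeasure_biasedCoin ht0.le ht1
  obtain ⟨c⟩ := nonempty_aeIso ((noise ((cellMeasure M).prod coinSeq) t).prod coinSeq) coinSeq
  refine ⟨M, t, ht0, ht1, c, s, hs, ?_⟩
  set R := skewProduct S hs (noisyMap Θ Ψ c) with hR
  have hnoise := measureReal_cellMap_noisyMap_ne (s := s) Θ Ψ c ht0.le ht1
  have hinvfst : ∀ᵐ z ∂(μ.prod μ), R₀.toFun (R₀.invFun z) =
      (S.toFun (R₀.invFun z).1, (Q (R₀.invFun z).1).toFun (R₀.invFun z).2) :=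
    R₀.mp_invFun.quasiMeasurePreserving.ae hRQ
  have hfst : ∀ᵐ z ∂(μ.prod μ), (R.toFun z).1 = (R₀.toFun z).1 := by
    filter_upwards [hRQ] with z hz
    rw [hz]; rfl
  have hfst' : ∀ᵐ z ∂(μ.prod μ), (R.invFun z).1 = (R₀.invFun z).1 := by
    filter_upwards [hinvfst, R₀.right_inv,
      (measurePreserving_fst.comp R₀.mp_invFun).quasiMeasurePreserving.ae S.left_inv]
      with z h1 h2 h3
    rw [h2] at h1
    exact (congrArg (fun w : X × X => S.invFun w.1) h1).trans h3
  -- the two approximation errors of the fine cells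
  have e3' : (μ.prod μ).real {z | pr (cellMap Θ M ((Q z.1).toFun z.2)) ≠ H (z.1, cellMap Θ M z.2)} < t := by
    refine lt_of_le_of_lt (ENNReal.toReal_mono (measure_ne_top _ _) (measure_mono_ae ?_)) e3
    filter_upwards [hRQ] with z hz hzne
    change cellMap Θ N (R₀.toFun z).2 ≠ _
    rw [hz]
    exact hzne
  have e4' : (μ.prod μ).real {z | pr (cellMap Θ M z.2) ≠
      H' (S.toFun z.1, cellMap Θ M ((Q z.1).toFun z.2))} < t := by
    have hmeas : MeasurableSet {z : X × X | cellMap Θ N (R₀.invFun z).2 ≠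
        H' (z.1, cellMap Θ M z.2)} :=
      measurableSet_finite_rel ((hcN.comp R₀.mp_invFun.measurable).prodMk (hH'.comp
        (measurable_fst.prodMk ((measurable_cellMap Θ M).comp measurable_snd))))
        fun w => w.1 ≠ w.2
    have e4'' := e4
    change (μ.prod μ).real {z | cellMap Θ N (R₀.invFun z).2 ≠ H' (z.1, cellMap Θ M z.2)} < t at e4''
    rw [← R₀.mp_toFun.measureReal_preimage hmeas.nullMeasurableSet] at e4''
    refine lt_of_le_of_lt (ENNReal.toReal_mono (measure_ne_top _ _) (measure_mono_ae ?_)) e4''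
    filter_upwards [hRQ, R₀.left_inv] with z hz hz' hzne
    change cellMap Θ N (R₀.invFun (R₀.toFun z)).2 ≠
      H' ((R₀.toFun z).1, cellMap Θ M (R₀.toFun z).2)
    rw [hz', hz]
    exact hzne
  have d1 : (μ.prod μ).real {z | cellMap Θ N (R.toFun z).2 ≠ cellMap Θ N (R₀.toFun z).2} ≤
      t + (μ.prod μ).real {z | pr (s z.1 (cellMap Θ M z.2)) ≠ pr (cellMap Θ M ((Q z.1).toFun z.2))} := by
    refine le_trans ?_ ((measureReal_union_le _ _).trans (add_le_add_left hnoise _))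
    refine ENNReal.toReal_mono (measure_ne_top _ _) (measure_mono_ae ?_)
    filter_upwards [hRQ] with z hz hzne
    by_contra hcon
    have hcon' : ¬ (cellMap Θ M ((noisyMap Θ Ψ c (s z.1)).toFun z.2) ≠ s z.1 (cellMap Θ M z.2) ∨
      pr (s z.1 (cellMap Θ M z.2)) ≠ pr (cellMap Θ M ((Q z.1).toFun z.2))) := hcon
    simp only [not_or, not_not] at hcon'
    refine hzne ?_
    change pr (cellMap Θ M ((noisyMap Θ Ψ c (s z.1)).toFun z.2)) = _
    rw [hcon'.1, hcon'.2, hz, hpr]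
  have d2 : (μ.prod μ).real {z | cellMap Θ N (R.invFun z).2 ≠ cellMap Θ N (R₀.invFun z).2} ≤
      t + (μ.prod μ).real {z | pr ((s z.1).symm (cellMap Θ M ((Q z.1).toFun z.2))) ≠
        pr (cellMap Θ M z.2)} := by
    have hc : Measurable fun z : X × X => cellMap Θ M z.2 :=
      (measurable_cellMap Θ M).comp measurable_snd
    have hs1 : Measurable fun z : X × X => s z.1 := hs.comp measurable_fst
    have hm1 : MeasurableSet {z : X × X | cellMap Θ M ((noisyMap Θ Ψ c (s z.1)).toFun z.2) ≠
        s z.1 (cellMap Θ M z.2)} :=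
      measurableSet_finite_rel (((hc.comp R.mp_toFun.measurable)).prodMk (hs1.prodMk hc))
        fun w => w.1 ≠ w.2.1 w.2.2
    have hm2 : MeasurableSet {z : X × X | pr ((s z.1).symm (cellMap Θ M ((Q z.1).toFun z.2))) ≠
        pr (cellMap Θ M z.2)} :=
      measurableSet_finite_rel ((hs1.prodMk (((measurable_cellMap Θ M).comp hQ))).prodMk hc)
        fun w => pr (w.1.1.symm w.1.2) ≠ pr w.2
    rw [← R.mp_invFun.measureReal_preimage hm1.nullMeasurableSet] at hnoise
    rw [← R₀.mp_invFun.measureReal_preimage hm2.nullMeasurableSet]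
    refine le_trans ?_ ((measureReal_union_le _ _).trans (add_le_add_left hnoise _))
    refine ENNReal.toReal_mono (measure_ne_top _ _) (measure_mono_ae ?_)
    filter_upwards [hinvfst, R₀.right_inv, R.right_inv, hfst'] with z h1 h2 h3 h4 hzne
    by_contra hcon
    have hcon' : ¬ (cellMap Θ M (R.toFun (R.invFun z)).2 ≠
        s (R.invFun z).1 (cellMap Θ M (R.invFun z).2) ∨
      pr ((s (R₀.invFun z).1).symm (cellMap Θ M ((Q (R₀.invFun z).1).toFun (R₀.invFun z).2))) ≠
        pr (cellMap Θ M (R₀.invFun z).2)) := hcon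
    simp only [not_or, not_not] at hcon'
    obtain ⟨h5, h6⟩ := hcon'
    rw [h2] at h1
    have h7 : (Q (R₀.invFun z).1).toFun (R₀.invFun z).2 = z.2 := by
      conv_rhs => rw [h1]
    refine hzne ?_
    rw [h7] at h6
    rw [h3, h4] at h5
    rw [← hpr, ← hpr, ← h6, h5, Equiv.symm_apply_apply]
  -- In each direction `2t` comes from approximating `A i` and `t` from the noise; the two
  -- permutation errors together are at most `2(t + t)`.
  have hterm : ∀ i < n, (μ.prod μ).real ((R.invFun ⁻¹' A i) ∆ (R₀.invFun ⁻¹' A i)) +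
      (μ.prod μ).real ((R.toFun ⁻¹' A i) ∆ (R₀.toFun ⁻¹' A i)) ≤ 10 * t := by
    intro i hi
    obtain ⟨Hi, hHi, hlt⟩ := hN i hi
    have hm : MeasurableSet {z : X × X | (z.1, cellMap Θ N z.2) ∈ Hi} :=
      (measurable_fst.prodMk hcN) hHi
    have h1 := measureReal_symmDiff_preimage_le R.mp_toFun R₀.mp_toFun hfst (hA i) hm
    have h2 := measureReal_symmDiff_preimage_le R.mp_invFun R₀.mp_invFun hfst' (hA i) hm
    linarith
  refine (halmosDist_le A R R₀ (by positivity) hterm).trans_lt ?_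
  linarith

end NoisyExtension

/-! ### Continuity of mean entropy in the Halmos metric. -/

section Continuity

variable {α ι : Type*} [MeasurableSpace α] {m : Measure α} [IsProbabilityMeasure m]
  [Fintype ι] [MeasurableSpace ι] [MeasurableSingletonClass ι]

theorem measureReal_symmDiff_triangle (s t u : Set α) :
    m.real (s ∆ u) ≤ m.real (s ∆ t) + m.real (t ∆ u) :=
  (measureReal_mono (symmDiff_triangle s t u) (measure_ne_top _ _)).trans
    (measureReal_union_le _ _)

theorem abs_measureReal_sub_le_symmDiff (s t : Set α) :
    |m.real s - m.real t| ≤ m.real (s ∆ t) := by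
  have h : ∀ s t : Set α, m.real s ≤ m.real (s ∆ t) + m.real t := fun s t =>
    (measureReal_mono (fun x hx => by
      by_cases hxt : x ∈ t
      · exact Or.inr hxt
      · exact Or.inl (Or.inl ⟨hx, hxt⟩)) (measure_ne_top _ _)).trans (measureReal_union_le _ _)
  rw [abs_sub_le_iff]
  have h1 := h s t
  have h2 := h t s
  rw [symmDiff_comm] at h2
  constructor <;> linarith

theorem tendsto_symmDiff_preimage_of_halmosMetric {A : ℕ → Set α} (hA : IsDenseFamily m A)
    (R₀ : MPAut m) {B : Set α} (hB : MeasurableSet B) :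
    Tendsto (fun R : MPAut m => m.real ((R.invFun ⁻¹' B) ∆ (R₀.invFun ⁻¹' B)))
      (letI := halmosMetric (μ := m) A; 𝓝 R₀) (𝓝 0) := by
  let := halmosMetric (μ := m) A
  rw [Metric.tendsto_nhds_nhds]
  intro ε hε
  obtain ⟨i, hi⟩ := hA.2 B hB (ε / 4) (by positivity)
  refine ⟨(1 / 2) ^ i * (ε / 4), by positivity, fun {R} hR => ?_⟩
  have hterm : (1 / 2 : ℝ) ^ i * m.real ((R.invFun ⁻¹' A i) ∆ (R₀.invFun ⁻¹' A i)) ≤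
      halmosDist A R R₀ :=
    le_trans (mul_le_mul_of_nonneg_left (le_add_of_nonneg_right measureReal_nonneg)
      (by positivity)) ((halmosDist_summable A R R₀).le_tsum i fun _ _ => by positivity)
  have h1 : m.real ((R.invFun ⁻¹' A i) ∆ (R₀.invFun ⁻¹' A i)) < ε / 4 :=
    lt_of_mul_lt_mul_left (hterm.trans_lt hR) (by positivity)
  have hm : NullMeasurableSet (A i ∆ B) m := ((hA.1 i).symmDiff hB).nullMeasurableSet
  have h2 : m.real ((R.invFun ⁻¹' A i) ∆ (R.invFun ⁻¹' B)) = m.real (A i ∆ B) :=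
    R.mp_invFun.measureReal_preimage hm
  have h3 : m.real ((R₀.invFun ⁻¹' A i) ∆ (R₀.invFun ⁻¹' B)) = m.real (A i ∆ B) :=
    R₀.mp_invFun.measureReal_preimage hm
  have h4 := measureReal_symmDiff_triangle (m := m) (R.invFun ⁻¹' B) (R.invFun ⁻¹' A i)
    (R₀.invFun ⁻¹' B)
  have h5 := measureReal_symmDiff_triangle (m := m) (R.invFun ⁻¹' A i) (R₀.invFun ⁻¹' A i)
    (R₀.invFun ⁻¹' B)
  rw [symmDiff_comm (R.invFun ⁻¹' B) (R.invFun ⁻¹' A i)] at h4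
  rw [Real.dist_eq, sub_zero, abs_of_nonneg measureReal_nonneg]
  linarith

variable {l : Filter (MPAut m)} {R₀ : MPAut m}

theorem tendsto_symmDiff_preimage_iterate
    (hl : ∀ B, MeasurableSet B →
      Tendsto (fun R : MPAut m => m.real ((R.invFun ⁻¹' B) ∆ (R₀.invFun ⁻¹' B))) l (𝓝 0))
    (p : ℕ) {B : Set α} (hB : MeasurableSet B) :
    Tendsto (fun R : MPAut m => m.real ((R.invFun^[p] ⁻¹' B) ∆ (R₀.invFun^[p] ⁻¹' B))) l (𝓝 0) := by
  induction p with
  | zero =>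
    simp only [Function.iterate_zero, preimage_id, symmDiff_self, bot_eq_empty,
      measureReal_empty]
    exact tendsto_const_nhds
  | succ p ih =>
    have hD := R₀.mp_invFun.measurable.iterate p hB
    have := ih.add (hl _ hD)
    rw [add_zero] at this
    refine squeeze_zero (fun _ => measureReal_nonneg) (fun R => ?_) this
    rw [Function.iterate_succ, Function.iterate_succ, preimage_comp, preimage_comp]
    -- In the intermediate set only the last step uses `R`. One difference is then a preimage under
    -- `R`, of the measure in the induction hypothesis; the other is a single step applied to a
    -- fixed set.
    refine (measureReal_symmDiff_triangle _ (R.invFun ⁻¹' (R₀.invFun^[p] ⁻¹' B)) _).trans ?_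
    rw [← preimage_symmDiff, R.mp_invFun.measureReal_preimage
      ((R.mp_invFun.measurable.iterate p hB).symmDiff hD).nullMeasurableSet]

theorem tendsto_meanEntropy
    (hl : ∀ B, MeasurableSet B →
      Tendsto (fun R : MPAut m => m.real ((R.invFun ⁻¹' B) ∆ (R₀.invFun ⁻¹' B))) l (𝓝 0))
    (P : Finset ℕ) {ξ : α → ι} (hξ : Measurable ξ) :
    Tendsto (fun R : MPAut m => meanEntropy R P ξ) l (𝓝 (meanEntropy R₀ P ξ)) := by
  refine Tendsto.div_const (tendsto_finsetSum _ fun u _ => ?_) _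
  refine (Real.continuous_negMulLog.tendsto _).comp ?_
  rw [tendsto_iff_dist_tendsto_zero]
  have hsum := tendsto_finsetSum (Finset.univ : Finset P) fun p _ =>
    tendsto_symmDiff_preimage_iterate hl p (hξ (measurableSet_singleton (u p)))
  rw [Finset.sum_const_zero] at hsum
  refine squeeze_zero (fun _ => dist_nonneg) (fun R => ?_) hsum
  rw [Real.dist_eq]
  refine (abs_measureReal_sub_le_symmDiff _ _).trans
    ((measureReal_mono ?_ (measure_ne_top _ _)).trans (measureReal_biUnion_finset_le _ _))
  intro x hx
  by_contra hcon
  simp only [Finset.mem_univ, iUnion_true, mem_iUnion, not_exists, Set.mem_symmDiff,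
    mem_preimage, mem_singleton_iff] at hcon
  have hiff : joinPartition R P ξ x = u ↔ joinPartition R₀ P ξ x = u := by
    simp only [funext_iff, joinPartition]
    refine forall_congr' fun p => ?_
    have := hcon p
    tauto
  rcases hx with ⟨h1, h2⟩ | ⟨h1, h2⟩
  · exact h2 (hiff.1 h1)
  · exact h2 (hiff.2 h1)

theorem isOpen_lt_meanEntropy {A : ℕ → Set α} (hA : IsDenseFamily m A) (P : Finset ℕ) {ξ : α → ι}
    (hξ : Measurable ξ) (c : ℝ) :
    letI := halmosMetric (μ := m) A
    IsOpen {R : MPAut m | c < meanEntropy R P ξ} := by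
  let := halmosMetric (μ := m) A
  rw [isOpen_iff_mem_nhds]
  intro R₀ hR₀
  exact (tendsto_meanEntropy (fun B hB => tendsto_symmDiff_preimage_of_halmosMetric hA R₀ hB) P
    hξ).eventually (lt_mem_nhds hR₀)

end Continuity

/-! ### Partitions with arbitrary finite index types. -/

section SequenceEntropy

variable {α ι : Type*} [MeasurableSpace α] {m : Measure α} [IsProbabilityMeasure m]
  [Fintype ι] [MeasurableSpace ι] [MeasurableSingletonClass ι]

theorem le_seqEntropy (P : ℕ → Finset ℕ) (T : MPAut m) {ξ : α → ι} (hξ : Measurable ξ) :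
    limsup (fun j => ((meanEntropy T (P j) ξ : ℝ) : EReal)) atTop ≤ seqEntropy P T := by
  let e := Fintype.equivFin ι
  have he : Measurable fun x => e (ξ x) := (measurable_of_finite e).comp hξ
  refine le_trans (limsup_le_limsup (Eventually.of_forall fun j => ?_)) (le_iSup_of_le
    (Fintype.card ι) (le_iSup_of_le (fun x => e (ξ x)) (le_iSup_of_le he le_rfl)))
  rw [EReal.coe_le_coe_iff]
  refine div_le_div_of_nonneg_right ?_ (Nat.cast_nonneg _)
  simpa using joinEntropy_comp_le T (P j) he e.symm

end SequenceEntropy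

/-! ### Progressions along which a zero-entropy automorphism has zero sequence entropy. -/

section ZeroEntropy

variable {X : Type*} [MeasurableSpace X] {μ : Measure X} [IsProbabilityMeasure μ]

theorem exists_progression_of_ksEntropy_eq_zero {ι : Type*} [Fintype ι] [MeasurableSpace ι]
    [MeasurableSingletonClass ι] {S : MPAut μ} (hS : ksEntropy S = 0) {ξ : X → ι}
    (hξ : Measurable ξ) {j : ℕ} (hj : 0 < j) {ε : ℝ} (hε : 0 < ε) :
    ∃ l, j ≤ l ∧
      partitionEntropy μ (joinPartition S ((Finset.Icc 1 l).image fun n => n * j) ξ) ≤ l * ε := by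
  have h1 := (le_seqEntropy Finset.range S hξ).trans hS.le
  -- The interval containing the progression has `l * j + 1 ≤ l * (j + 1)` points.
  have hε' : 0 < ε / (j + 1) := by positivity
  have h2 := eventually_lt_of_limsup_lt (h1.trans_lt (EReal.coe_pos.2 hε'))
  obtain ⟨k₀, hk₀⟩ := eventually_atTop.1 h2
  set l := max k₀ j
  have hjl : j ≤ l := le_max_right _ _
  refine ⟨l, hjl, ?_⟩
  have h3 := hk₀ (l * j + 1) ((le_max_left k₀ j).trans
    ((Nat.le_mul_of_pos_right l hj).trans (Nat.le_succ _)))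
  rw [EReal.coe_lt_coe_iff, meanEntropy, Finset.card_range, div_lt_iff₀ (by positivity)] at h3
  have hsub : ((Finset.Icc 1 l).image fun n => n * j) ⊆ Finset.range (l * j + 1) := by
    intro p hp
    obtain ⟨n, hn, rfl⟩ := Finset.mem_image.1 hp
    exact Finset.mem_range.2 (Nat.lt_succ_of_le (Nat.mul_le_mul_right j (Finset.mem_Icc.1 hn).2))
  refine (joinEntropy_mono_subset S hsub hξ).trans (h3.le.trans ?_)
  have hl : (1 : ℝ) ≤ l := by exact_mod_cast (show 1 ≤ l by omega)
  push_cast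
  rw [div_mul_eq_mul_div, div_le_iff₀ (by positivity)]
  nlinarith

theorem exists_cell_fun_approx' (Θ : AEIso μ (coinSeq.prod coinSeq)) {τ : Type*} [Fintype τ]
    [Nonempty τ] [MeasurableSpace τ] [MeasurableSingletonClass τ] {f : X → τ}
    (hf : Measurable f) {ε : ℝ} (hε : 0 < ε) :
    ∃ (M : ℕ) (H : Cell M → τ), μ.real {x | f x ≠ H (cellMap Θ M x)} < ε := by
  obtain ⟨M, h⟩ := exists_cell_fun_approx (μ := Measure.dirac ()) Θ (hf.comp measurable_snd) hε
  obtain ⟨H, -, hlt⟩ := h M le_rfl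
  refine ⟨M, fun k => H ((), k), lt_of_le_of_lt ?_ hlt⟩
  rw [Measure.dirac_prod]
  exact ENNReal.toReal_mono (by finiteness)
    (Measure.le_map_apply (measurable_prodMk_left).aemeasurable _)

instance instMeasurableSpaceOption (n : ℕ) : MeasurableSpace (Option (Fin n)) := ⊤

instance instDiscreteMeasurableSpaceOption (n : ℕ) :
    DiscreteMeasurableSpace (Option (Fin n)) :=
  ⟨fun _ => trivial⟩

/-- A partition with one atom of nearly full measure and a bounded number of others has small
entropy, as `negMulLog` is continuous and vanishes at 0 and 1. Here `none` will mean that an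
approximation is correct. -/
theorem exists_partitionEntropy_lt (n : ℕ) {ε : ℝ} (hε : 0 < ε) :
    ∃ η > 0, ∀ ζ : X → Option (Fin n), Measurable ζ → μ.real (ζ ⁻¹' {none}ᶜ) < η →
      partitionEntropy μ ζ < ε := by
  have hε' : 0 < ε / (n + 2) := by positivity
  have h0 := (Metric.continuous_iff.1 Real.continuous_negMulLog) 0 _ hε'
  have h1 := (Metric.continuous_iff.1 Real.continuous_negMulLog) 1 _ hε'
  obtain ⟨η₀, hη₀, h0⟩ := h0
  obtain ⟨η₁, hη₁, h1⟩ := h1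
  refine ⟨min η₀ η₁, lt_min hη₀ hη₁, fun ζ hζ hlt => ?_⟩
  have hm : MeasurableSet (ζ ⁻¹' {none}) := hζ (measurableSet_singleton _)
  have hterm : ∀ o, Real.negMulLog (μ.real (ζ ⁻¹' {o})) ≤ ε / (n + 2) := by
    intro o
    cases o with
    | none =>
      have h2 : μ.real (ζ ⁻¹' {none}) = 1 - μ.real (ζ ⁻¹' {none}ᶜ) := by
        rw [preimage_compl, probReal_compl_eq_one_sub hm]; ring
      have := h1 (μ.real (ζ ⁻¹' {none})) (by
        rw [Real.dist_eq, h2, sub_sub_cancel_left, abs_neg, abs_of_nonneg measureReal_nonneg]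
        exact hlt.trans_le (min_le_right _ _))
      rw [Real.negMulLog_one, Real.dist_eq, sub_zero] at this
      exact (le_abs_self _).trans this.le
    | some i =>
      have h2 : μ.real (ζ ⁻¹' {some i}) ≤ μ.real (ζ ⁻¹' {none}ᶜ) :=
        measureReal_mono (preimage_mono (by simp)) (measure_ne_top _ _)
      have := h0 (μ.real (ζ ⁻¹' {some i})) (by
        rw [Real.dist_eq, sub_zero, abs_of_nonneg measureReal_nonneg]
        exact h2.trans_lt (hlt.trans_le (min_le_left _ _)))
      rw [Real.negMulLog_zero, Real.dist_eq, sub_zero] at this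
      exact (le_abs_self _).trans this.le
  refine (Finset.sum_le_sum fun o _ => hterm o).trans_lt ?_
  rw [Finset.sum_const, nsmul_eq_mul, Finset.card_univ, Fintype.card_option, Fintype.card_fin,
    mul_div_assoc', div_lt_iff₀ (by positivity)]
  push_cast
  nlinarith

theorem exists_seqEntropy_progressions_eq_zero (Θ : AEIso μ (coinSeq.prod coinSeq)) {S : MPAut μ}
    (hS : ksEntropy S = 0) :
    ∃ L : ℕ → ℕ, Tendsto L atTop atTop ∧ seqEntropy (progressions L) S = 0 := by
  -- A diagonal choice: `L j` controls the `j`-th cell partition, which refines all earlier ones.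
  -- The value at `j = 0` does not affect the upper limit.
  have hL : ∀ j : ℕ, ∃ l, j ≤ l ∧ (0 < j →
      partitionEntropy μ (joinPartition S ((Finset.Icc 1 l).image fun n => n * j)
        (cellMap Θ j)) ≤ l * (1 / (j + 1 : ℝ))) := by
    intro j
    rcases j.eq_zero_or_pos with rfl | hj
    · exact ⟨0, le_rfl, fun h => absurd h (lt_irrefl 0)⟩
    · obtain ⟨l, h1, h2⟩ := exists_progression_of_ksEntropy_eq_zero hS (measurable_cellMap Θ j) hj
        (show (0 : ℝ) < 1 / (j + 1) by positivity)
      exact ⟨l, h1, fun _ => h2⟩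
  choose L hjL hL using hL
  have htend : ∀ (n : ℕ) (ξ : X → Fin n), Measurable ξ →
      Tendsto (fun j => meanEntropy S (progressions L j) ξ) atTop (𝓝 0) := by
    intro n ξ hξ
    have hne : Nonempty (Fin n) := by
      obtain ⟨x⟩ := nonempty_of_isProbabilityMeasure μ
      exact ⟨ξ x⟩
    rw [Metric.tendsto_atTop]
    intro ε hε
    obtain ⟨η, hη, hζη⟩ := exists_partitionEntropy_lt (μ := μ) n (half_pos hε)
    obtain ⟨M, H, hlt⟩ := exists_cell_fun_approx' Θ hξ hη
    have hHm : Measurable fun x => H (cellMap Θ M x) :=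
      (measurable_of_finite H).comp (measurable_cellMap Θ M)
    -- `ζ` records the true value of `ξ` exactly where the cell function errs.
    let G : Fin n × Fin n → Option (Fin n) := fun p => if p.1 = p.2 then none else some p.1
    let ζ : X → Option (Fin n) := fun x => G (ξ x, H (cellMap Θ M x))
    have hζ : Measurable ζ := (measurable_of_finite G).comp (hξ.prodMk hHm)
    have hζlt : partitionEntropy μ ζ < ε / 2 := by
      refine hζη ζ hζ (lt_of_le_of_lt (measureReal_mono ?_ (measure_ne_top _ _)) hlt)
      intro x hx h
      exact hx (if_pos h)
    have hξζ : ξ = fun x => (fun (k : Cell M) (o : Option (Fin n)) => o.getD (H k))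
        (cellMap Θ M x) (ζ x) := by
      funext x
      by_cases h : ξ x = H (cellMap Θ M x)
      · simp [ζ, G, h]
      · simp [ζ, G, h]
    obtain ⟨J, hJ⟩ := exists_nat_one_div_lt (half_pos hε)
    refine ⟨max (max M J) 1, fun j hj => ?_⟩
    have hjM : M ≤ j := (le_max_left _ _).trans ((le_max_left _ _).trans hj)
    have hjJ : J ≤ j := (le_max_right _ _).trans ((le_max_left _ _).trans hj)
    have hj0 : 0 < j := (le_max_right _ _).trans hj
    have hLpos : (0 : ℝ) < L j := by exact_mod_cast hj0.trans_le (hjL j)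
    have h0 : 0 ≤ meanEntropy S (progressions L j) ξ :=
      div_nonneg (partitionEntropy_nonneg _) (Nat.cast_nonneg _)
    rw [Real.dist_eq, sub_zero, abs_of_nonneg h0, meanEntropy, card_progressions L hj0,
      div_lt_iff₀ hLpos]
    have h1 := joinEntropy_le_add S (progressions L j) (measurable_cellMap Θ M) hζ
      (fun (k : Cell M) (o : Option (Fin n)) => o.getD (H k))
    rw [← hξζ, card_progressions L hj0] at h1
    have h2 : partitionEntropy μ (joinPartition S (progressions L j) (cellMap Θ M)) ≤
        partitionEntropy μ (joinPartition S (progressions L j) (cellMap Θ j)) :=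
      joinEntropy_comp_le S (progressions L j) (measurable_cellMap Θ j) (cellRestrict hjM)
    have h3 : partitionEntropy μ (joinPartition S (progressions L j) (cellMap Θ j)) ≤
        L j * (1 / (j + 1 : ℝ)) := hL j hj0
    have h4 : 1 / (j + 1 : ℝ) ≤ 1 / (J + 1 : ℝ) := by
      have : (J : ℝ) ≤ j := by exact_mod_cast hjJ
      gcongr
    have h5 : 1 / (j + 1 : ℝ) + partitionEntropy μ ζ < ε := by linarith
    nlinarith
  refine ⟨L, tendsto_atTop_mono hjL tendsto_id, ?_⟩
  have hlim : ∀ (n : ℕ) (ξ : X → Fin n), Measurable ξ →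
      limsup (fun j => ((meanEntropy S (progressions L j) ξ : ℝ) : EReal)) atTop = 0 :=
    fun n ξ hξ => ((continuous_coe_real_ereal.tendsto 0).comp (htend n ξ hξ)).limsup_eq
  refine le_antisymm (iSup_le fun n => iSup_le fun ξ => iSup_le fun hξ => (hlim n ξ hξ).le) ?_
  exact le_iSup_of_le 1 (le_iSup_of_le (fun _ => 0) (le_iSup_of_le measurable_const
    (hlim 1 _ measurable_const).ge))

end ZeroEntropy

/-! ### Genericity of infinite sequence entropy. -/

section Generic

variable {X : Type*} [MeasurableSpace X] {μ : Measure X} [IsProbabilityMeasure μ]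

theorem IsGenericIn.mono {α : Type*} [MeasurableSpace α] {m : Measure α} [IsProbabilityMeasure m]
    {A : ℕ → Set α} {E W W' : Set (MPAut m)} (h : IsGenericIn A E W) (hW : W ⊆ W') :
    IsGenericIn A E W' :=
  let ⟨G, h1, h2, h3⟩ := h
  ⟨G, h1, h2, fun R hR => hW (h3 R hR)⟩

theorem isGenericIn_seqEntropy_eq_top (Θ : AEIso μ (coinSeq.prod coinSeq))
    (Ψ : AEIso coinSeq (coinSeq.prod coinSeq)) {A : ℕ → Set (X × X)}
    (hA : IsDenseFamily (μ.prod μ) A) {L : ℕ → ℕ} (hL : Tendsto L atTop atTop) (S : MPAut μ) :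
    IsGenericIn A (Ext S) {R | seqEntropy (progressions L) R = ⊤} := by
  let := halmosMetric (μ := μ.prod μ) A
  -- To exceed `k`, `2(k + 1)` bits suffice, because `2 log 2 > 1`. The partition must not depend on
  -- the approximating extension, so it may use more bits than the cells of that extension do.
  let U : ℕ × ℕ → Set (Ext S) := fun p => {R | ∃ j, p.2 ≤ j ∧
    (p.1 : ℝ) < meanEntropy (R : MPAut (μ.prod μ)) (progressions L j)
      (headPartition Θ (2 * (p.1 + 1)))}
  have hU : ∀ p, IsOpen (U p) := by
    intro p
    have : U p = ⋃ j, ⋃ _ : p.2 ≤ j, Subtype.val ⁻¹' {R : MPAut (μ.prod μ) |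
        (p.1 : ℝ) < meanEntropy R (progressions L j) (headPartition Θ (2 * (p.1 + 1)))} := by
      ext R; simp [U]
    rw [this]
    exact isOpen_iUnion fun j => isOpen_iUnion fun _ =>
      (isOpen_lt_meanEntropy hA _ (measurable_headPartition Θ _) _).preimage continuous_subtype_val
  refine ⟨⋂ p, U p, IsGδ.iInter_of_isOpen hU, ?_, ?_⟩
  · rw [Metric.dense_iff]
    intro R₀ ε hε
    obtain ⟨M, δ, hδ0, hδ1, c, s, hs, hlt⟩ :=
      exists_noisyMap_halmosDist_lt Θ Ψ S hA.1 R₀.2 hε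
    refine ⟨⟨_, skewProduct_mem_Ext S hs (noisyMap Θ Ψ c)⟩, hlt, mem_iInter.2 fun p => ?_⟩
    -- However small `δ` is, the growing step `j` leaves time for a refresh with probability tending
    -- to 1.
    have hpow : Tendsto (fun j : ℕ => (1 - (1 - δ) ^ j) *
        ((2 * (p.1 + 1) : ℕ) * Real.log 2)) atTop
        (𝓝 ((1 - 0) * ((2 * (p.1 + 1) : ℕ) * Real.log 2))) :=
      ((tendsto_const_nhds).sub (tendsto_pow_atTop_nhds_zero_of_lt_one (by linarith)
        (by linarith))).mul_const _
    have hlog : (p.1 : ℝ) < (1 - 0) * ((2 * (p.1 + 1) : ℕ) * Real.log 2) := by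
      have := Real.log_two_gt_d9
      have hp : (0 : ℝ) ≤ p.1 := Nat.cast_nonneg _
      push_cast
      nlinarith
    obtain ⟨j, h1, h2, h3, h4⟩ := ((hpow.eventually (lt_mem_nhds hlog)).and
      ((eventually_ge_atTop p.2).and ((eventually_gt_atTop 0).and
        (hL.eventually (eventually_gt_atTop 0))))).exists
    exact ⟨j, h2, h1.trans_le (le_meanEntropy_noisyMap Θ Ψ c S hs hδ0.le hδ1 L h3 h4 _)⟩
  · intro R hR
    refine EReal.eq_top_iff_forall_lt _ |>.2 fun y => ?_
    obtain ⟨k, hk⟩ := exists_nat_gt y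
    refine lt_of_lt_of_le (EReal.coe_lt_coe_iff.2 hk) (le_trans ?_
      (le_seqEntropy (progressions L) (R : MPAut (μ.prod μ))
        (measurable_headPartition Θ (2 * (k + 1)))))
    refine le_limsup_of_frequently_le (frequently_atTop.2 fun N => ?_)
    obtain ⟨j, h1, h2⟩ := mem_iInter.1 hR (k, N)
    exact ⟨j, h1, EReal.coe_le_coe_iff.2 h2.le⟩

end Generic

end GenericExt

end
-- The four assertions.
theorem mainTheorem3 {X : Type*} [MeasurableSpace X] [StandardBorelSpace X]
    (μ : Measure X) [IsProbabilityMeasure μ] [NullSingletonClass μ]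
    (A : ℕ → Set (X × X)) (hA : GenericExt.IsDenseFamily (μ.prod μ) A) :
    (∀ S : GenericExt.MPAut μ, GenericExt.ksEntropy S = 0 →
      ∃ L : ℕ → ℕ, Tendsto L atTop atTop ∧
        GenericExt.seqEntropy (GenericExt.progressions L) S = 0) ∧
    (∀ L : ℕ → ℕ, Tendsto L atTop atTop → ∀ S : GenericExt.MPAut μ,
      GenericExt.IsGenericIn A (GenericExt.Ext S)
        {R | GenericExt.seqEntropy (GenericExt.progressions L) R = ⊤}) ∧
    (∀ S : GenericExt.MPAut μ, GenericExt.ksEntropy S = 0 →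
      GenericExt.IsGenericIn A (GenericExt.Ext S) {R | ¬ GenericExt.Isomorphic R S}) ∧
    (∀ L : ℕ → ℕ, Tendsto L atTop atTop →
      GenericExt.IsExquisite A
        {S : GenericExt.MPAut μ | GenericExt.seqEntropy (GenericExt.progressions L) S < ⊤}) := by
  obtain ⟨Θ⟩ := GenericExt.nonempty_aeIso μ (GenericExt.coinSeq.prod GenericExt.coinSeq)
  obtain ⟨Ψ⟩ := GenericExt.nonempty_aeIso GenericExt.coinSeq
    (GenericExt.coinSeq.prod GenericExt.coinSeq)
  refine ⟨fun S hS => GenericExt.exists_seqEntropy_progressions_eq_zero Θ hS,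
    fun L hL S => GenericExt.isGenericIn_seqEntropy_eq_top Θ Ψ hA hL S, fun S hS => ?_,
    fun L hL S _ => ?_⟩
  · obtain ⟨L, hL, hL0⟩ := GenericExt.exists_seqEntropy_progressions_eq_zero Θ hS
    refine (GenericExt.isGenericIn_seqEntropy_eq_top Θ Ψ hA hL S).mono fun R hR hiso => ?_
    have := GenericExt.seqEntropy_le_of_isomorphic hiso (GenericExt.progressions L)
    rw [hL0, show GenericExt.seqEntropy (GenericExt.progressions L) R = ⊤ from hR] at this
    simp at this
  · refine (GenericExt.isGenericIn_seqEntropy_eq_top Θ Ψ hA hL S).mono fun R hR hiso => ?_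
    obtain ⟨S', hS', hiso⟩ := hiso
    have := GenericExt.seqEntropy_le_of_isomorphic hiso (GenericExt.progressions L)
    rw [show GenericExt.seqEntropy (GenericExt.progressions L) R = ⊤ from hR] at this
    exact absurd hS' (not_lt.2 this)
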